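/- All polynomials have coefficients in $\{0,1\}$ and operate modulo two; a quadratic polynomial is one of degree at most $2$. For $n\ge 1$ let $e^1=\sum_{i\le n}x_i$ and $e^2=\sum_{i<j\le n}x_ix_j$. Write $w(x)=\sum_i x_i\in\mathbb N$ for the Hamming weight of $x\in\{0,1\}^n$. For an integer $m$ and a polynomial $p$ in $n$ variables, the Boolean mod-$m$ correlation of $p$ is $$B_m(p):=\Bigl|\,\mathbb E_{x\in\{0,1\}^n:\ m\mid w(x)}(-1)^{p(x)}-\mathbb E_{x\in\{0,1\}^n:\ m\nmid w(x)}(-1)^{p(x)}\Bigr|,$$ where both expectations are uniform, and $B_m^*$ is the maximum of $B_m(p)$ over all quadratic $p$ in $n$ variables. For an angle $\theta$ let $v_\theta:=2^{-n-1}\bigl((1+\sin\theta)^n+(1-\sin\theta)^n\bigr)$. **Theorem.** Fix an odd $m\ge 3$. Let $\varphi:=2\pi/m$, let $\ell_1\in\{\frac{m-1}4,\frac{m+1}4\}$ be the integer closest to $m/4$, and set $\Psi:=\frac{2m}{m-1}\sqrt{v_{\ell_1\varphi}}$. The following holds for all large enough $n$, where $o(1)$ denotes quantities (of either sign) that tend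 to $0$ as $n\to\infty$ with $m$ fixed, and $c>0$ is a constant that depends only on $m$. 1. $\Psi\,(1/\sqrt2-o(1))\le B_m^*\le\Psi\,(1+o(1))$. 2. If $n\equiv m$ or $3m\pmod{4m}$, then $$B_m^*=\max_{s\in\{e^2,\,e^2+e^1\}}B_m(s)=\Psi\,(1-o(1)).$$ 3. If $n\equiv 0$ or $2m\pmod{4m}$, then $$(1+c)\max_{s\in\{0,\,e^1,\,e^2,\,e^2+e^1\}}B_m(s)<\max_{s'\in\{e^2,\,e^2+e^1\}}B_m\bigl(a\,x_1+s'(x_2,\dots,x_n)\bigr),$$ where $a=1$ if $m\equiv 3\pmod 4$ (that is, $\ell_1=\frac{m+1}4$) and $a=0$ if $m\equiv 1\pmod 4$ (that is, $\ell_1=\frac{m-1}4$). -/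

import Mathlib

open Filter Topology
open scoped BigOperators

noncomputable section

/-- Points of `{0,1}^n`, with `{0,1}` identified with `ZMod 2`. -/
abbrev Cube (n : ℕ) : Type := Fin n → ZMod 2

/-- Polynomials in `n` variables with coefficients in `{0,1}`, operating modulo two. -/
abbrev Poly2 (n : ℕ) : Type := MvPolynomial (Fin n) (ZMod 2)

/-- The number of ones of `x`, i.e. `∑ x_i` computed in `ℕ`. -/
def cubeWeight {n : ℕ} (x : Cube n) : ℕ := ∑ i, (x i).val

/-- The boolean mod `m` function: `0` if `m` divides the weight of `x`, and `1` otherwise. -/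
def boolMod (m : ℕ) {n : ℕ} (x : Cube n) : ZMod 2 :=
  if m ∣ cubeWeight x then 0 else 1

/-- `(-1)^{p(x)}`. -/
def polySign {n : ℕ} (p : Poly2 n) (x : Cube n) : ℝ :=
  (-1) ^ (MvPolynomial.eval x p).val

/-- `B_m(p) = |E_{x : BMod_m(x) = 0} (-1)^{p(x)} - E_{x : BMod_m(x) = 1} (-1)^{p(x)}|`. -/
def boolCorr (m : ℕ) {n : ℕ} (p : Poly2 n) : ℝ :=
  |(𝔼 x ∈ (Finset.univ : Finset (Cube n)).filter (fun x => boolMod m x = 0), polySign p x) -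
    (𝔼 x ∈ (Finset.univ : Finset (Cube n)).filter (fun x => boolMod m x = 1), polySign p x)|

/-- The set of values `B_m(p)` for `p` quadratic, that is, of degree at most two. -/
def quadCorrs (m n : ℕ) : Set ℝ :=
  {b | ∃ p : Poly2 n, p.totalDegree ≤ 2 ∧ b = boolCorr m p}

/-- `B_m^*`: the maximum of `B_m(p)` over all quadratic polynomials `p` in `n` variables. -/
def maxQuadCorr (m n : ℕ) : ℝ := sSup (quadCorrs m n)

/-- The maximum is attained. -/
theorem maxQuadCorr_isGreatest (m n : ℕ) :
    IsGreatest (quadCorrs m n) (maxQuadCorr m n) := by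
  have hfin : (quadCorrs m n).Finite := by
    refine (Set.finite_range (fun f : Cube n → ZMod 2 =>
      |(𝔼 x ∈ (Finset.univ : Finset (Cube n)).filter (fun x => boolMod m x = 0),
          (-1 : ℝ) ^ (f x).val) -
        (𝔼 x ∈ (Finset.univ : Finset (Cube n)).filter (fun x => boolMod m x = 1),
          (-1 : ℝ) ^ (f x).val)|)).subset ?_
    rintro b ⟨p, -, rfl⟩
    exact ⟨fun x => MvPolynomial.eval x p, rfl⟩
  have hne : (quadCorrs m n).Nonempty := ⟨_, 0, by simp, rfl⟩
  exact ⟨hne.csSup_mem hfin, fun b hb => le_csSup hfin.bddAbove hb⟩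

/-- The elementary symmetric polynomial `e^1 = ∑ x_i`. -/
def elemSym1 (n : ℕ) : Poly2 n := MvPolynomial.esymm (Fin n) (ZMod 2) 1

/-- The elementary symmetric polynomial `e^2 = ∑_{i<j} x_i x_j`. -/
def elemSym2 (n : ℕ) : Poly2 n := MvPolynomial.esymm (Fin n) (ZMod 2) 2

/-- `s(x_2, …, x_{n+1})` as a polynomial in `x_1, …, x_{n+1}`. -/
def onTail {n : ℕ} (s : Poly2 n) : Poly2 (n + 1) := MvPolynomial.rename Fin.succ s

/-- `v_φ = 2^{-n-1} ((1 + sin φ)^n + (1 - sin φ)^n)`. -/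
def vAngle (n : ℕ) (φ : ℝ) : ℝ :=
  ((1 + Real.sin φ) ^ n + (1 - Real.sin φ) ^ n) / 2 ^ (n + 1)

/-- `ℓ₁`, the integer closest to `m / 4`. -/
def ellOne (m : ℕ) : ℤ := round ((m : ℝ) / 4)

/-- `Ψ = (2m / (m - 1)) √v_{ℓ₁ φ}` with `φ = 2π / m`. -/
def psiBound (m n : ℕ) : ℝ :=
  2 * (m : ℝ) / ((m : ℝ) - 1) * √(vAngle n ((ellOne m : ℝ) * (2 * Real.pi / (m : ℝ))))

end

/-!
Write `w` for the Hamming weight and, for `z` on the unit circle, let `E_z(p)` be the mean of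
`(-1)^p z^w` over the cube (`twistedMean`). Expanding the condition `m ∣ w` over the `m`-th roots
of unity expresses the Boolean correlation of `p` through the numbers `E_z(p)` with `z^m = 1`.

For a quadratic `p` whose polar form has the alternating matrix `A`, expanding `|E_z(p)|²` over
shifts `h` gives `|E_z(p)|² ≤ 2^{-n} ∑_h ∏_i w(h_i, (Ah)_i)`, where `w(0,0) = 1`, `w(0,1) = 0`,
`w(1,0) = |Re z|` and `w(1,1) = |Im z|` (`normSq_twistedMean_le_pairSum`). Hence
`|E_z(p)|² ≤ ((1 + max (|Re z|, |Im z|)) / 2)^n`, and among the nontrivial `m`-th roots of unity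
only `z = exp (±i ℓ₁ φ)`, whose argument `θ` is closest to a right angle, contribute on the scale
`σ^n = ((1 + sin θ) / 2)^{n/2}`. So the correlation is `(2m / (m - 1)) |Re E_z(p)|` up to an error
`o(σ^n)` that is uniform in `p` (`NearestQuarter.abs_boolCorr_sub_le`).

If `A` is not the matrix of the complete graph, the sum over `h` is at most `β (1 + sin θ)^n` with
`β < 1/2` for large `n` (`exists_pairSum_le`): a vector `h` loses a factor `cot θ` for each nonzero
entry of `(A + 1) h`, and `A + 1` has rank at least two. If many rows of `A + 1` coincide, this row
and a different one suffice; otherwise `A + 1` has large rank, and linear images of the weighted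
cube do not concentrate (`fiberMass_mul_le`). If `A` is the matrix of the complete graph, then `p`
is `e²` plus a linear form, `(-1)^{e²}` is a combination of `i^w` and `(-i)^w`, and `E_z(p)` is a
sum of two products; it is smaller by a fixed factor unless the linear form is `0` or `e¹`
up to a constant. So only `e²` and `e² + e¹` can reach modulus about `σ^n / √2`.

For these two, `E_z` is asymptotically `(σ^n / √2) exp (i (nη ± π/4))` with `η = ±π / (4m)`. The
two phases differ by a right angle, so one of the real parts is at least `1/√2` times the modulus.
If `n` is an odd multiple of `m`, then one of the phases is real; if `n` is an even multiple of
`m`, then both lose exactly `1/√2`. In the last case, splitting off one variable replaces a factor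
of modulus `σ` by `(1 ± z) / 2`, of modulus `σ (1 + tan (π / 4m)) / √2`, and turns the phase so
that one of the values becomes real, a gain by the factor `1 + tan (π / 4m)`.
-/

/-! ### Signs, quadratic forms and twisted means on the cube -/

/-- The sign `(-1)^a` of `a ∈ {0,1}`. -/
def bitSign (a : ZMod 2) : ℝ := (-1) ^ a.val

theorem zmod_two_cases (a : ZMod 2) : a = 0 ∨ a = 1 := by
  revert a; decide

theorem bitSign_zero : bitSign 0 = 1 := by simp [bitSign]

theorem bitSign_one : bitSign 1 = -1 := by simp [bitSign, ZMod.val_one]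

theorem bitSign_add (a b : ZMod 2) : bitSign (a + b) = bitSign a * bitSign b := by
  rcases zmod_two_cases a with rfl | rfl <;> rcases zmod_two_cases b with rfl | rfl <;>
    simp [bitSign_zero, bitSign_one, show (1 : ZMod 2) + 1 = 0 from rfl]

theorem abs_bitSign (a : ZMod 2) : |bitSign a| = 1 := by
  rcases zmod_two_cases a with rfl | rfl <;> simp [bitSign_zero, bitSign_one]

theorem bitSign_sum {ι : Type*} (s : Finset ι) (f : ι → ZMod 2) :
    bitSign (∑ i ∈ s, f i) = ∏ i ∈ s, bitSign (f i) := by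
  classical
  induction s using Finset.induction_on with
  | empty => simp [bitSign_zero]
  | insert a s ha ih => rw [Finset.sum_insert ha, Finset.prod_insert ha, bitSign_add, ih]

theorem add_self_zmod_two (a : ZMod 2) : a + a = 0 := by
  revert a; decide

theorem sum_cube_prod {R : Type*} [CommSemiring R] {n : ℕ} (F : Fin n → ZMod 2 → R) :
    ∑ x : Cube n, ∏ i, F i (x i) = ∏ i, (F i 0 + F i 1) := by
  have h := Finset.prod_univ_sum (fun _ : Fin n => (Finset.univ : Finset (ZMod 2))) F
  rw [Fintype.piFinset_univ] at h
  rw [← h]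
  refine Finset.prod_congr rfl fun i _ => ?_
  exact Fin.sum_univ_two (F i)

theorem pow_cubeWeight {n : ℕ} (z : ℂ) (x : Cube n) :
    z ^ cubeWeight x = ∏ i, z ^ (x i).val := by
  rw [cubeWeight, Finset.prod_pow_eq_pow_sum]

/-- The quadratic form `∑ U i j x_i x_j` over the field with two elements. Since `x_i² = x_i`, its
diagonal part is an arbitrary linear form. -/
def quadForm {n : ℕ} (U : Fin n → Fin n → ZMod 2) (x : Cube n) : ZMod 2 :=
  ∑ i, ∑ j, U i j * (x i * x j)

/-- The alternating matrix `U + Uᵀ` of the polar form of `quadForm U`, applied to `h`. -/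
def polarMap {n : ℕ} (U : Fin n → Fin n → ZMod 2) (h : Cube n) (i : Fin n) : ZMod 2 :=
  ∑ j, (U i j + U j i) * h j

theorem quadForm_add {n : ℕ} (U : Fin n → Fin n → ZMod 2) (x h : Cube n) :
    quadForm U (x + h) = quadForm U x + quadForm U h + ∑ i, x i * polarMap U h i := by
  have e : ∑ i, x i * polarMap U h i =
      (∑ i, ∑ j, U i j * (x i * h j)) + ∑ i, ∑ j, U i j * (h i * x j) := by
    rw [Finset.sum_comm (f := fun i j => U i j * (h i * x j)), ← Finset.sum_add_distrib]
    refine Finset.sum_congr rfl fun i _ => ?_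
    rw [polarMap, Finset.mul_sum, ← Finset.sum_add_distrib]
    exact Finset.sum_congr rfl fun j _ => by ring
  rw [e]
  simp only [quadForm, ← Finset.sum_add_distrib, Pi.add_apply]
  refine Finset.sum_congr rfl fun i _ => Finset.sum_congr rfl fun j _ => by ring

theorem exists_quadForm_of_totalDegree_le_two {n : ℕ} (p : Poly2 n) (hp : p.totalDegree ≤ 2) :
    ∃ (c : ZMod 2) (U : Fin n → Fin n → ZMod 2),
      ∀ x, MvPolynomial.eval x p = c + quadForm U x := by
  classical
  have key : ∀ s : Finset (Fin n →₀ ℕ), s ⊆ p.support → ∃ (c : ZMod 2)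
      (U : Fin n → Fin n → ZMod 2), ∀ x : Cube n,
        ∑ d ∈ s, MvPolynomial.coeff d p * ∏ i ∈ d.support, x i ^ d i = c + quadForm U x := by
    intro s
    induction s using Finset.induction_on with
    | empty => intro _; exact ⟨0, 0, fun x => by simp [quadForm]⟩
    | insert d s hd ih =>
      intro hs
      obtain ⟨c, U, hU⟩ := ih ((Finset.subset_insert _ _).trans hs)
      have hdeg : (d.sum fun _ e => e) ≤ 2 :=
        (MvPolynomial.le_totalDegree (hs (Finset.mem_insert_self _ _))).trans hp
      have hcard : d.support.card ≤ 2 := by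
        refine le_trans ?_ hdeg
        rw [Finsupp.sum, Finset.card_eq_sum_ones]
        exact Finset.sum_le_sum fun i hi =>
          Nat.one_le_iff_ne_zero.2 (Finsupp.mem_support_iff.1 hi)
      have hpow : ∀ x : Cube n, ∏ i ∈ d.support, x i ^ d i = ∏ i ∈ d.support, x i := fun x =>
        Finset.prod_congr rfl fun i hi => by
          have h0 := Finsupp.mem_support_iff.1 hi
          rcases zmod_two_cases (x i) with h | h <;> simp [h, h0]
      have hmono : ∃ (c' : ZMod 2) (V : Fin n → Fin n → ZMod 2), ∀ x : Cube n,
          MvPolynomial.coeff d p * ∏ i ∈ d.support, x i = c' + quadForm V x := by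
        have hsingle : ∀ (a b : Fin n) (x : Cube n) (t : ZMod 2),
            quadForm (fun i j => if i = a then (if j = b then t else 0) else 0) x
              = t * (x a * x b) := by
          intro a b x t
          simp [quadForm, ite_mul, Finset.sum_ite_eq']
        have : d.support.card = 0 ∨ d.support.card = 1 ∨ d.support.card = 2 := by omega
        rcases this with h | h | h
        · rw [Finset.card_eq_zero] at h
          exact ⟨MvPolynomial.coeff d p, 0, fun x => by simp [h, quadForm]⟩
        · obtain ⟨a, ha⟩ := Finset.card_eq_one.1 h
          refine ⟨0, fun i j => if i = a then (if j = a then MvPolynomial.coeff d p else 0) else 0,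
            fun x => ?_⟩
          rw [hsingle, ha, Finset.prod_singleton, zero_add]
          rcases zmod_two_cases (x a) with h | h <;> simp [h]
        · obtain ⟨a, b, hab, hs2⟩ := Finset.card_eq_two.1 h
          refine ⟨0, fun i j => if i = a then (if j = b then MvPolynomial.coeff d p else 0) else 0,
            fun x => ?_⟩
          rw [hsingle, hs2, Finset.prod_pair hab, zero_add]
      obtain ⟨c', V, hV⟩ := hmono
      refine ⟨c' + c, fun i j => V i j + U i j, fun x => ?_⟩
      rw [Finset.sum_insert hd, hU, hpow, hV]
      have : quadForm (fun i j => V i j + U i j) x = quadForm V x + quadForm U x := by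
        simp only [quadForm, ← Finset.sum_add_distrib]
        exact Finset.sum_congr rfl fun i _ => Finset.sum_congr rfl fun j _ => by ring
      rw [this]; ring
  obtain ⟨c, U, h⟩ := key p.support (Finset.Subset.refl _)
  exact ⟨c, U, fun x => by rw [MvPolynomial.eval_eq, h]⟩

/-- The mean of `(-1)^{f(x)} z^{w(x)}` over the cube, where `w` is the Hamming weight. -/
noncomputable def twistedMean {n : ℕ} (z : ℂ) (f : Cube n → ZMod 2) : ℂ :=
  (∑ x : Cube n, (bitSign (f x) : ℂ) * z ^ cubeWeight x) / 2 ^ n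

/-- One coordinate of the weight in the pair-correlation expansion: `h` is the shift bit and `a`
the coefficient of the corresponding variable in the derivative of the quadratic form. -/
def pairWeight (c s : ℝ) (h a : ZMod 2) : ℝ :=
  if h = 0 then (if a = 0 then 1 else 0) else (if a = 0 then c else s)

/-- The sum `∑_h ∏_i w(h_i, (Ah)_i)`, with `A = U + Uᵀ`, that dominates `2^n |E (-1)^q z^w|²` for
every quadratic `q` with polar matrix `A`. -/
def pairSum {n : ℕ} (c s : ℝ) (U : Fin n → Fin n → ZMod 2) : ℝ :=
  ∑ h : Cube n, ∏ i, pairWeight c s (h i) (polarMap U h i)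

/-- The squared modulus is a sum over shifts `h`; for each `h` the derivative of the quadratic
form in direction `h` is affine, so the inner sum over `x` factors over the coordinates. -/
theorem normSq_twistedMean_le_pairSum {n : ℕ} (z : ℂ) (hz : ‖z‖ = 1) (c₀ : ZMod 2)
    (U : Fin n → Fin n → ZMod 2) (f : Cube n → ZMod 2) (hf : ∀ x, f x = c₀ + quadForm U x) :
    ‖twistedMean z f‖ ^ 2 ≤ pairSum |z.re| |z.im| U / 2 ^ n := by
  have hzz : (starRingEnd ℂ) z * z = 1 := by
    rw [mul_comm, Complex.mul_conj, Complex.normSq_eq_norm_sq, hz]; norm_num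
  set F : Cube n → ℂ := fun x => (bitSign (f x) : ℂ) * z ^ cubeWeight x with hF
  have hadd : (starRingEnd ℂ) (∑ x, F x) * ∑ x, F x
      = ∑ h : Cube n, ∑ x : Cube n, (starRingEnd ℂ) (F x) * F (x + h) := by
    rw [map_sum, Finset.sum_mul_sum, Finset.sum_comm' (t' := Finset.univ)
      (s' := fun _ => Finset.univ) (by simp), Finset.sum_comm,
      Finset.sum_comm (f := fun h x => (starRingEnd ℂ) (F x) * F (x + h))]
    refine Finset.sum_congr rfl fun x _ => ?_
    exact (Fintype.sum_equiv (Equiv.addLeft x) _ _ fun h => rfl).symm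
  have hterm : ∀ h : Cube n, ‖∑ x : Cube n, (starRingEnd ℂ) (F x) * F (x + h)‖
      = 2 ^ n * ∏ i, pairWeight |z.re| |z.im| (h i) (polarMap U h i) := by
    intro h
    have h1 : ∀ x : Cube n, (starRingEnd ℂ) (F x) * F (x + h) =
        (bitSign (quadForm U h) : ℂ) * ∏ i, ((bitSign (x i * polarMap U h i) : ℂ) *
          ((starRingEnd ℂ) z ^ (x i).val * z ^ (x i + h i).val)) := by
      intro x
      have e1 : bitSign (f x) * bitSign (f (x + h)) =
          bitSign (quadForm U h) * ∏ i, bitSign (x i * polarMap U h i) := by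
        rw [← bitSign_sum, ← bitSign_add, ← bitSign_add, hf, hf, quadForm_add]
        congr 1
        linear_combination add_self_zmod_two c₀ + add_self_zmod_two (quadForm U x)
      have e1' := congrArg (fun r : ℝ => (r : ℂ)) e1
      push_cast at e1'
      rw [Finset.prod_mul_distrib, ← mul_assoc (bitSign (quadForm U h) : ℂ), ← e1',
        Finset.prod_mul_distrib]
      simp only [hF, map_mul, Complex.conj_ofReal, map_pow, pow_cubeWeight, map_prod,
        Pi.add_apply]
      ring
    rw [Finset.sum_congr rfl fun x _ => h1 x, ← Finset.mul_sum,
      sum_cube_prod (fun i a => ((bitSign (a * polarMap U h i) : ℂ) *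
          ((starRingEnd ℂ) z ^ a.val * z ^ (a + h i).val))), norm_mul,
      Complex.norm_real, Real.norm_eq_abs, abs_bitSign, one_mul, norm_prod]
    have h2 : (2 : ℝ) ^ n = ∏ _i : Fin n, (2 : ℝ) := by simp
    rw [h2, ← Finset.prod_mul_distrib]
    refine Finset.prod_congr rfl fun i _ => ?_
    have hre : z + (starRingEnd ℂ) z = ((2 * z.re : ℝ) : ℂ) := Complex.add_conj z
    have him : z - (starRingEnd ℂ) z = ((2 * z.im : ℝ) : ℂ) * Complex.I := Complex.sub_conj z
    rcases zmod_two_cases (h i) with h0 | h0 <;>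
      rcases zmod_two_cases (polarMap U h i) with ha | ha <;>
      simp only [h0, ha, pairWeight, bitSign_zero, bitSign_one, mul_zero, mul_one, add_zero,
        zero_add, ZMod.val_zero, ZMod.val_one, pow_zero, pow_one, if_true, Complex.ofReal_one,
        one_mul, one_ne_zero, if_false, show (1 : ZMod 2) + 1 = 0 from rfl, hzz,
        Complex.ofReal_neg]
    · norm_num
    · norm_num
    · rw [hre, Complex.norm_real, Real.norm_eq_abs, abs_mul]; norm_num
    · rw [neg_one_mul, ← sub_eq_add_neg, him, norm_mul, Complex.norm_I, mul_one,
        Complex.norm_real, Real.norm_eq_abs, abs_mul]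
      norm_num
  have hnorm : ‖∑ x, F x‖ ^ 2 ≤ 2 ^ n * pairSum |z.re| |z.im| U := by
    have : ‖∑ x, F x‖ ^ 2 = ‖(starRingEnd ℂ) (∑ x, F x) * ∑ x, F x‖ := by
      rw [norm_mul, RCLike.norm_conj, sq]
    rw [this, hadd, pairSum, Finset.mul_sum]
    exact (norm_sum_le _ _).trans (Finset.sum_le_sum fun h _ => (hterm h).le)
  have hE : ‖twistedMean z f‖ = ‖∑ x, F x‖ / 2 ^ n := by
    simp [twistedMean, hF]
  rw [hE, div_pow, div_le_div_iff₀ (by positivity) (by positivity)]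
  calc ‖∑ x, F x‖ ^ 2 * 2 ^ n ≤ (2 ^ n * pairSum |z.re| |z.im| U) * 2 ^ n := by gcongr
    _ = pairSum |z.re| |z.im| U * (2 ^ n) ^ 2 := by ring

theorem pairWeight_nonneg {c s : ℝ} (hc : 0 ≤ c) (hs : 0 ≤ s) (h a : ZMod 2) :
    0 ≤ pairWeight c s h a := by
  unfold pairWeight; split_ifs <;> first | assumption | norm_num

theorem pairSum_le {n : ℕ} {c s t : ℝ} (hc : 0 ≤ c) (hs : 0 ≤ s) (hct : c ≤ t) (hst : s ≤ t)
    (U : Fin n → Fin n → ZMod 2) : pairSum c s U ≤ (1 + t) ^ n := by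
  have h1 : ∑ h : Cube n, ∏ i, (if h i = 0 then 1 else t) = (1 + t) ^ n := by
    rw [sum_cube_prod (fun _ a => if a = 0 then (1 : ℝ) else t)]
    simp
  rw [pairSum, ← h1]
  refine Finset.sum_le_sum fun h _ => Finset.prod_le_prod
    (fun i _ => pairWeight_nonneg hc hs _ _) fun i _ => ?_
  unfold pairWeight; split_ifs <;> first | assumption | norm_num

theorem norm_twistedMean_sq_le {n : ℕ} (z : ℂ) (hz : ‖z‖ = 1) {t : ℝ} (hre : |z.re| ≤ t)
    (him : |z.im| ≤ t) (p : Poly2 n) (hp : p.totalDegree ≤ 2) :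
    ‖twistedMean z (fun x : Cube n => MvPolynomial.eval x p)‖ ^ 2 ≤ ((1 + t) / 2) ^ n := by
  obtain ⟨c, U, hU⟩ := exists_quadForm_of_totalDegree_le_two p hp
  refine (normSq_twistedMean_le_pairSum z hz c U _ hU).trans ?_
  rw [div_pow]
  gcongr
  exact pairSum_le (abs_nonneg _) (abs_nonneg _) hre him U

theorem twistedMean_linear {n : ℕ} (z : ℂ) (b : Fin n → ZMod 2) :
    twistedMean z (fun x : Cube n => ∑ i, b i * x i) =
      ∏ i, ((1 + (bitSign (b i) : ℂ) * z) / 2) := by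
  have h : ∀ x : Cube n, (bitSign (∑ i, b i * x i) : ℂ) * z ^ cubeWeight x =
      ∏ i, ((bitSign (b i * x i) : ℂ) * z ^ (x i).val) := fun x => by
    rw [pow_cubeWeight, bitSign_sum, Finset.prod_mul_distrib]; push_cast; rfl
  rw [twistedMean, Finset.sum_congr rfl fun x _ => h x,
    sum_cube_prod (fun i a => (bitSign (b i * a) : ℂ) * z ^ a.val), Finset.prod_div_distrib]
  simp [bitSign_zero, ZMod.val_one]

/-! ### Anticoncentration of linear maps under a product weight -/

/-- The product weight that gives weight `s` to each coordinate equal to one. -/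
def cubeMass {n : ℕ} (s : ℝ) (h : Cube n) : ℝ := ∏ i, if h i = 0 then 1 else s

theorem cubeMass_nonneg {n : ℕ} {s : ℝ} (hs : 0 ≤ s) (h : Cube n) : 0 ≤ cubeMass s h :=
  Finset.prod_nonneg fun i _ => by split_ifs <;> first | assumption | norm_num

theorem sum_cubeMass {n : ℕ} (s : ℝ) : ∑ h : Cube n, cubeMass s h = (1 + s) ^ n := by
  have := sum_cube_prod (n := n) (fun _ a => if a = 0 then (1 : ℝ) else s)
  simp only [cubeMass, this]
  simp

theorem sum_cube_succ {R : Type*} [AddCommMonoid R] {n : ℕ} (F : Cube (n + 1) → R) :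
    ∑ x, F x = ∑ h : Cube n, F (Fin.cons (0 : ZMod 2) h) +
      ∑ h : Cube n, F (Fin.cons (1 : ZMod 2) h) := by
  rw [← (Fin.consEquiv (fun _ : Fin (n + 1) => ZMod 2)).sum_comp, Fintype.sum_prod_type]
  exact Fin.sum_univ_two _

/-- The total mass of a fibre of a linear map, given by the images `c i` of the unit vectors, is at
most `(1 + s)^(n - d)`, where `d` is the rank: an atom of one bit has relative mass at most
`1 / (1 + s)`, and each column that enlarges the span fixes one bit. -/
theorem fiberMass_mul_le {V : Type*} [AddCommGroup V] [Module (ZMod 2) V]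
    [FiniteDimensional (ZMod 2) V] [DecidableEq V] {s : ℝ} (hs : 0 ≤ s) (hs1 : s ≤ 1) (n : ℕ)
    (c : Fin n → V) (v : V) :
    (∑ h : Cube n, if ∑ i, h i • c i = v then cubeMass s h else 0) *
      (1 + s) ^ Module.finrank (ZMod 2) (Submodule.span (ZMod 2) (Set.range c)) ≤ (1 + s) ^ n := by
  induction n generalizing v with
  | zero =>
    have hr : Set.range c = ∅ := Set.range_eq_empty c
    rw [hr, Submodule.span_empty, finrank_bot]
    simp only [pow_zero, mul_one]
    rw [Fintype.sum_unique]
    split_ifs <;> simp [cubeMass]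
  | succ n ih =>
    set c' : Fin n → V := fun i => c i.succ with hc'
    set S : V → ℝ := fun v => ∑ h : Cube n, if ∑ i, h i • c' i = v then cubeMass s h else 0
      with hS
    set W := Submodule.span (ZMod 2) (Set.range c') with hW
    have hS0 : ∀ v, v ∉ W → S v = 0 := fun v hv => by
      refine Finset.sum_eq_zero fun h _ => if_neg fun e => hv ?_
      rw [← e]
      exact Submodule.sum_mem _ fun i _ =>
        Submodule.smul_mem _ _ (Submodule.subset_span ⟨i, rfl⟩)
    have hSn : ∀ v, 0 ≤ S v := fun v => Finset.sum_nonneg fun h _ => by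
      split_ifs
      · exact cubeMass_nonneg hs h
      · rfl
    have hsplit : (∑ h : Cube (n + 1), if ∑ i, h i • c i = v then cubeMass s h else 0)
        = S v + s * S (v - c 0) := by
      rw [sum_cube_succ]
      congr 1
      · refine Finset.sum_congr rfl fun h _ => ?_
        simp [Fin.sum_univ_succ, cubeMass, Fin.prod_univ_succ, hc']
      · rw [Finset.mul_sum]
        refine Finset.sum_congr rfl fun h _ => ?_
        simp [Fin.sum_univ_succ, cubeMass, Fin.prod_univ_succ, hc',
          eq_sub_iff_add_eq, add_comm]
    have hrange : Set.range c = insert (c 0) (Set.range c') := by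
      ext w; constructor
      · rintro ⟨i, rfl⟩
        refine Fin.cases (Or.inl rfl) (fun j => Or.inr ⟨j, rfl⟩) i
      · rintro (rfl | ⟨j, rfl⟩)
        · exact ⟨0, rfl⟩
        · exact ⟨j.succ, rfl⟩
    rw [hsplit, hrange]
    by_cases h0 : c 0 ∈ W
    · rw [Submodule.span_insert_eq_span h0, ← hW, pow_succ]
      have h1 := ih c' v
      have h2 := ih c' (v - c 0)
      change S v * _ ≤ _ at h1
      change S (v - c 0) * _ ≤ _ at h2
      nlinarith
    · have hfin : Module.finrank (ZMod 2) (Submodule.span (ZMod 2) (insert (c 0) (Set.range c')))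
          ≤ Module.finrank (ZMod 2) W + 1 := by
        rw [Submodule.span_insert, ← hW]
        refine (Submodule.finrank_add_le_finrank_add_finrank _ _).trans ?_
        have := finrank_span_singleton (K := ZMod 2) (v := c 0)
          (fun h => h0 (h ▸ W.zero_mem))
        omega
      have hsum : ∃ w, S v + s * S (v - c 0) ≤ S w := by
        by_cases hv : v ∈ W
        · have : v - c 0 ∉ W := fun h => h0 (by simpa using W.sub_mem hv h)
          exact ⟨v, by rw [hS0 _ this]; simp⟩
        · refine ⟨v - c 0, ?_⟩
          rw [hS0 _ hv]
          nlinarith [hSn (v - c 0)]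
      obtain ⟨w, hw⟩ := hsum
      have h1 := ih c' w
      change S w * _ ≤ _ at h1
      calc _ ≤ S w * (1 + s) ^ (Module.finrank (ZMod 2) W + 1) := by
            refine mul_le_mul hw (pow_le_pow_right₀ (by linarith) hfin) (by positivity) (hSn w)
        _ = (S w * (1 + s) ^ Module.finrank (ZMod 2) W) * (1 + s) := by ring
        _ ≤ (1 + s) ^ n * (1 + s) := by gcongr
        _ = (1 + s) ^ (n + 1) := by ring

theorem sum_cubeMass_mul_le {n d : ℕ} {s : ℝ} (hs : 0 ≤ s) (hs1 : s ≤ 1)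
    (r : Fin d → Cube n) (hr : LinearIndependent (ZMod 2) r) (G : Cube d → ℝ)
    (hG : ∀ y, 0 ≤ G y) :
    (∑ h : Cube n, cubeMass s h * G (fun k => ∑ i, r k i * h i)) * (1 + s) ^ d ≤
      (1 + s) ^ n * ∑ y, G y := by
  classical
  -- The rows `r` are independent, so the columns of the same matrix span.
  set c : Fin n → Cube d := fun i k => r k i with hc
  have hfr : Module.finrank (ZMod 2) (Submodule.span (ZMod 2) (Set.range c)) = d := by
    have h1 := LinearIndependent.rank_matrix (M := Matrix.of r) hr
    rw [Matrix.rank_eq_finrank_span_cols, Fintype.card_fin] at h1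
    exact h1
  have hlin : ∀ h : Cube n, (fun k => ∑ i, r k i * h i) = ∑ i, h i • c i := fun h => by
    funext k
    simp [Finset.sum_apply, hc, mul_comm]
  have hsum : ∑ h : Cube n, cubeMass s h * G (fun k => ∑ i, r k i * h i) =
      ∑ y, (∑ h : Cube n, if ∑ i, h i • c i = y then cubeMass s h else 0) * G y := by
    simp only [Finset.sum_mul]
    rw [Finset.sum_comm]
    refine Finset.sum_congr rfl fun h _ => ?_
    rw [hlin]
    simp
  rw [hsum, Finset.sum_mul, Finset.mul_sum]
  refine Finset.sum_le_sum fun y _ => ?_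
  have := fiberMass_mul_le hs hs1 n c y
  rw [hfr] at this
  calc _ = ((∑ h : Cube n, if ∑ i, h i • c i = y then cubeMass s h else 0) *
        (1 + s) ^ d) * G y := by ring
    _ ≤ _ := mul_le_mul_of_nonneg_right this (hG y)

/-! ### Polar matrices other than the complete graph -/

/-- The rows of `U + Uᵀ + 1`. -/
def polarRow {n : ℕ} (U : Fin n → Fin n → ZMod 2) (i : Fin n) : Cube n :=
  fun j => U i j + U j i + if i = j then 1 else 0

theorem polarRow_self {n : ℕ} (U : Fin n → Fin n → ZMod 2) (i : Fin n) : polarRow U i i = 1 := by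
  simp [polarRow, add_self_zmod_two]

theorem sum_polarRow_mul {n : ℕ} (U : Fin n → Fin n → ZMod 2) (h : Cube n) (i : Fin n) :
    ∑ j, polarRow U i j * h j = polarMap U h i + h i := by
  simp [polarRow, polarMap, add_mul, Finset.sum_add_distrib]

/-- The penalty for a bit of `(U + Uᵀ + 1) h` equal to one. -/
def bitPenalty (ρ : ℝ) (y : ZMod 2) : ℝ := if y = 0 then 1 else ρ

theorem bitPenalty_nonneg {ρ : ℝ} (h : 0 ≤ ρ) (y : ZMod 2) : 0 ≤ bitPenalty ρ y := by
  unfold bitPenalty; split_ifs <;> first | assumption | norm_num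

theorem bitPenalty_le_one {ρ : ℝ} (h : ρ ≤ 1) (y : ZMod 2) : bitPenalty ρ y ≤ 1 := by
  unfold bitPenalty; split_ifs <;> first | assumption | norm_num

theorem sum_prod_bitPenalty (d : ℕ) (ρ : ℝ) :
    ∑ y : Cube d, ∏ k, bitPenalty ρ (y k) = (1 + ρ) ^ d := by
  rw [sum_cube_prod (fun _ a => bitPenalty ρ a)]
  simp [bitPenalty]

theorem pairSum_le_sum_of_penalty {n : ℕ} {c s ρ : ℝ} (hs : 0 ≤ s) (hc : 0 ≤ c) (hρ : 0 ≤ ρ)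
    (hcρ : c = s * ρ) (U : Fin n → Fin n → ZMod 2) (G : Cube n → ℝ)
    (hG : ∀ h : Cube n, ∏ i, bitPenalty ρ (∑ j, polarRow U i j * h j) ≤ G h) :
    pairSum c s U ≤ ∑ h : Cube n, cubeMass s h * G h := by
  refine Finset.sum_le_sum fun h _ => ?_
  refine le_trans ?_ (mul_le_mul_of_nonneg_left (hG h) (cubeMass_nonneg hs h))
  rw [cubeMass, ← Finset.prod_mul_distrib]
  refine Finset.prod_le_prod (fun i _ => pairWeight_nonneg hc hs _ _) fun i _ => ?_
  rw [sum_polarRow_mul]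
  rcases zmod_two_cases (h i) with h0 | h0 <;>
    rcases zmod_two_cases (polarMap U h i) with ha | ha <;>
    simp [h0, ha, pairWeight, bitPenalty, hρ, hcρ, show (1 : ZMod 2) + 1 = 0 from rfl]

/-- If the matrix `U + Uᵀ + 1` has rank at least `d`, then `pairSum` is small. -/
theorem pairSum_mul_le_of_linearIndependent {n d : ℕ} {c s ρ : ℝ} (hs : 0 ≤ s) (hs1 : s ≤ 1)
    (hc : 0 ≤ c) (hρ : 0 ≤ ρ) (hρ1 : ρ ≤ 1) (hcρ : c = s * ρ) (U : Fin n → Fin n → ZMod 2)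
    (r : Fin d → Fin n) (hr : LinearIndependent (ZMod 2) fun k => polarRow U (r k)) :
    pairSum c s U * (1 + s) ^ d ≤ (1 + s) ^ n * (1 + ρ) ^ d := by
  have hinj : Function.Injective r := fun a b hab => hr.injective (by simp [hab])
  have h1 := pairSum_le_sum_of_penalty hs hc hρ hcρ U
    (fun h => ∏ k, bitPenalty ρ (∑ j, polarRow U (r k) j * h j)) fun h => by
      rw [← Finset.prod_image (s := Finset.univ) (g := r)
        (f := fun i => bitPenalty ρ (∑ j, polarRow U i j * h j)) (fun a _ b _ e => hinj e)]
      refine Finset.prod_le_prod_of_subset_of_le_one (Finset.subset_univ _)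
        (fun i _ => bitPenalty_nonneg hρ _) (fun i _ _ => bitPenalty_le_one hρ1 _)
  have h2 := sum_cubeMass_mul_le hs hs1 (fun k => polarRow U (r k)) hr
    (fun y => ∏ k, bitPenalty ρ (y k)) fun y => Finset.prod_nonneg fun k _ =>
      bitPenalty_nonneg hρ _
  rw [sum_prod_bitPenalty] at h2
  exact (mul_le_mul_of_nonneg_right h1 (by positivity)).trans h2

/-- If more than `K` rows of `U + Uᵀ + 1` are equal to one row and some row differs from it, then
`pairSum` is small: the weight of the vectors not orthogonal to the repeated row carries the
penalty `ρ^K`, and the two different rows are independent. -/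
theorem pairSum_mul_le_of_repeated_row {n K : ℕ} {c s ρ : ℝ} (hs : 0 ≤ s) (hs1 : s ≤ 1)
    (hc : 0 ≤ c) (hρ : 0 ≤ ρ) (hρ1 : ρ ≤ 1) (hcρ : c = s * ρ) (U : Fin n → Fin n → ZMod 2)
    (a b : Fin n) (hab : polarRow U a ≠ polarRow U b)
    (hK : K < (Finset.univ.filter fun i => polarRow U i = polarRow U a).card) :
    pairSum c s U ≤ (1 + s) ^ n * ((1 + ρ) / (1 + s) ^ 2 + ρ ^ K) := by
  have hne : ∀ i, polarRow U i ≠ 0 := fun i h => by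
    have := polarRow_self U i
    rw [h] at this
    simp at this
  have hr : LinearIndependent (ZMod 2) ![polarRow U a, polarRow U b] := by
    rw [LinearIndependent.pair_iff]
    intro x y hxy
    rcases zmod_two_cases x with rfl | rfl <;> rcases zmod_two_cases y with rfl | rfl
    · simp
    · simp only [zero_smul, one_smul, zero_add] at hxy
      exact absurd hxy (hne b)
    · simp only [zero_smul, one_smul, add_zero] at hxy
      exact absurd hxy (hne a)
    · refine absurd ?_ hab
      simp only [one_smul] at hxy
      funext j
      have h1 := congrFun hxy j
      simp only [Pi.add_apply, Pi.zero_apply] at h1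
      linear_combination h1 - add_self_zmod_two (polarRow U b j)
  set ya : Cube n → ZMod 2 := fun h => ∑ j, polarRow U a j * h j with hya
  set yb : Cube n → ZMod 2 := fun h => ∑ j, polarRow U b j * h j with hyb
  have h1 := pairSum_le_sum_of_penalty hs hc hρ hcρ U
    (fun h => (if ya h = 0 then bitPenalty ρ (yb h) else 0) + ρ ^ K) fun h => by
      have hle : ∀ T : Finset (Fin n), ∏ i, bitPenalty ρ (∑ j, polarRow U i j * h j) ≤
          ∏ i ∈ T, bitPenalty ρ (∑ j, polarRow U i j * h j) := fun T =>
        Finset.prod_le_prod_of_subset_of_le_one (Finset.subset_univ _)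
          (fun i _ => bitPenalty_nonneg hρ _) (fun i _ _ => bitPenalty_le_one hρ1 _)
      by_cases hy : ya h = 0
      · rw [if_pos hy]
        refine (hle {b}).trans ?_
        rw [Finset.prod_singleton]
        exact le_add_of_nonneg_right (pow_nonneg hρ _)
      · rw [if_neg hy, zero_add]
        refine (hle (Finset.univ.filter fun i => polarRow U i = polarRow U a)).trans ?_
        rw [Finset.prod_congr rfl (g := fun _ => ρ), Finset.prod_const]
        · exact pow_le_pow_of_le_one hρ hρ1 hK.le
        · intro i hi
          rw [(Finset.mem_filter.1 hi).2]
          exact if_neg hy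
  have h2 := sum_cubeMass_mul_le hs hs1 _ hr
    (fun y => if y 0 = 0 then bitPenalty ρ (y 1) else 0) fun y => by
      split_ifs
      · exact bitPenalty_nonneg hρ _
      · rfl
  have h3 : ∑ y : Cube 2, (if y 0 = 0 then bitPenalty ρ (y 1) else 0) = 1 + ρ := by
    have h4 : ∀ y : Cube 2, (if y 0 = 0 then bitPenalty ρ (y 1) else 0) =
        ∏ i, (fun i a => if i = 0 then (if a = 0 then 1 else 0) else bitPenalty ρ a) i (y i) := by
      intro y
      rw [Fin.prod_univ_two]
      simp
    rw [Finset.sum_congr rfl fun y _ => h4 y, sum_cube_prod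
      (fun (i : Fin 2) a => if i = 0 then (if a = 0 then (1 : ℝ) else 0) else bitPenalty ρ a),
      Fin.prod_univ_two]
    simp [bitPenalty]
  rw [h3] at h2
  simp only [Matrix.cons_val_zero, Matrix.cons_val_one] at h2
  have h5 : ∑ h : Cube n, cubeMass s h * (if ya h = 0 then bitPenalty ρ (yb h) else 0) ≤
      (1 + s) ^ n * ((1 + ρ) / (1 + s) ^ 2) := by
    rw [← mul_div_assoc, le_div_iff₀ (by positivity)]
    exact h2
  refine h1.trans ?_
  simp only [mul_add, Finset.sum_add_distrib]
  rw [← Finset.sum_mul, sum_cubeMass]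
  linarith

/-- Off the complete graph, `pairSum` is at most a fixed fraction below one half of `(1 + s)^n`.
Either some row of `U + Uᵀ + 1` is repeated many times, or there are many different rows and the
rank is large. -/
theorem exists_pairSum_le {c s ρ : ℝ} (hs : 0 < s) (hs1 : s ≤ 1)
    (hc : 0 ≤ c) (hρ : 0 ≤ ρ) (hρs : ρ < s) (hcρ : c = s * ρ)
    (hhalf : (1 + ρ) / (1 + s) ^ 2 < 1 / 2) :
    ∃ β : ℝ, 0 ≤ β ∧ β < 1 / 2 ∧ ∀ᶠ n : ℕ in atTop, ∀ U : Fin n → Fin n → ZMod 2,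
      (∃ i j, i ≠ j ∧ U i j + U j i ≠ 1) → pairSum c s U ≤ β * (1 + s) ^ n := by
  classical
  have hρ1 : ρ < 1 := hρs.trans_le hs1
  set κ := (1 + ρ) / (1 + s) ^ 2 with hκ
  have hκ0 : 0 < κ := by positivity
  -- Both cases below lose at most half of the gap between `κ` and one half.
  obtain ⟨K, hK⟩ := exists_pow_lt_of_lt_one (show 0 < (1 / 2 - κ) / 2 by linarith) hρ1
  have hlam : (1 + ρ) / (1 + s) < 1 := by rw [div_lt_one (by positivity)]; linarith
  obtain ⟨r₀, hr₀⟩ := exists_pow_lt_of_lt_one hκ0 hlam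
  refine ⟨κ + (1 / 2 - κ) / 2, by linarith, by linarith, ?_⟩
  filter_upwards [eventually_gt_atTop (2 ^ r₀ * K)] with n hn U hU
  obtain ⟨i₀, j₀, hij, hUij⟩ := hU
  have hij0 : polarRow U i₀ j₀ = 0 := by
    have h0 : U i₀ j₀ + U j₀ i₀ = 0 := (zmod_two_cases _).resolve_right hUij
    simp [polarRow, h0, hij]
  have hdiff : polarRow U i₀ ≠ polarRow U j₀ := fun h => by
    have h1 := congrFun h j₀
    rw [hij0, polarRow_self] at h1
    exact zero_ne_one h1
  set D : Finset (Cube n) := Finset.univ.image (polarRow U) with hD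
  by_cases hcard : D.card * K < n
  · obtain ⟨y, hy, hyK⟩ := Finset.exists_lt_card_fiber_of_mul_lt_card_of_maps_to
      (s := (Finset.univ : Finset (Fin n))) (t := D) (f := polarRow U) (n := K)
      (fun a _ => Finset.mem_image_of_mem _ (Finset.mem_univ a)) (by simpa using hcard)
    obtain ⟨a, -, rfl⟩ := Finset.mem_image.1 hy
    have hb : ∃ b, polarRow U a ≠ polarRow U b := by
      by_contra hcon
      push Not at hcon
      exact hdiff ((hcon i₀).symm.trans (hcon j₀))
    obtain ⟨b, hab⟩ := hb
    refine (pairSum_mul_le_of_repeated_row hs.le hs1 hc hρ hρ1.le hcρ U a b hab hyK).trans ?_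
    rw [mul_comm]
    gcongr
  -- Otherwise there are more than `2 ^ r₀` different rows, and they span a space of dimension at
  -- least `r₀`.
  · have hDcard : 2 ^ r₀ < D.card := by
      by_contra hcon
      push Not at hcon hcard
      have := Nat.mul_le_mul_right K hcon
      omega
    obtain ⟨f, hf, -, hli⟩ := Submodule.exists_fun_fin_finrank_span_eq (ZMod 2)
      (Set.range (polarRow U))
    set d := Module.finrank (ZMod 2) (Submodule.span (ZMod 2) (Set.range (polarRow U))) with hd
    have hdr : r₀ ≤ d := by
      have h1 : D.card ≤ 2 ^ d := by
        have h2 := Module.card_eq_pow_finrank (K := ZMod 2)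
          (V := Submodule.span (ZMod 2) (Set.range (polarRow U)))
        rw [ZMod.card, ← hd] at h2
        rw [← h2, ← Fintype.card_coe]
        refine Fintype.card_le_of_injective (fun y => ⟨y.1, Submodule.subset_span ?_⟩) ?_
        · obtain ⟨a, -, ha⟩ := Finset.mem_image.1 y.2
          exact ⟨a, ha⟩
        · intro y y' h
          exact Subtype.ext (Subtype.mk.inj h)
      exact (Nat.pow_le_pow_iff_right (by norm_num)).1 (hDcard.le.trans h1)
    choose r hr using hf
    have hli' : LinearIndependent (ZMod 2) fun k => polarRow U (r k) := by
      rw [funext hr]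
      exact hli
    have h1 := pairSum_mul_le_of_linearIndependent hs.le hs1 hc hρ hρ1.le hcρ U r hli'
    have h2 : pairSum c s U ≤ (1 + s) ^ n * ((1 + ρ) / (1 + s)) ^ d := by
      rw [div_pow, ← mul_div_assoc, le_div_iff₀ (by positivity)]
      exact h1
    have h3 : ((1 + ρ) / (1 + s)) ^ d ≤ ((1 + ρ) / (1 + s)) ^ r₀ :=
      pow_le_pow_of_le_one (by positivity) hlam.le hdr
    refine h2.trans ?_
    rw [mul_comm]
    gcongr
    linarith

/-! ### The complete graph: symmetric quadratic forms up to a linear form -/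

theorem cubeWeight_eq_card {n : ℕ} (x : Cube n) :
    cubeWeight x = (Finset.univ.filter fun i => x i = 1).card := by
  rw [cubeWeight, Finset.card_filter]
  refine Finset.sum_congr rfl fun i _ => ?_
  rcases zmod_two_cases (x i) with h | h <;> simp [h, ZMod.val_one]

theorem eval_elemSym1 {n : ℕ} (x : Cube n) : MvPolynomial.eval x (elemSym1 n) = ∑ i, x i := by
  rw [elemSym1, MvPolynomial.esymm_one, map_sum]
  simp

theorem eval_elemSym2 {n : ℕ} (x : Cube n) :
    MvPolynomial.eval x (elemSym2 n) = ((cubeWeight x).choose 2 : ZMod 2) := by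
  have h : ∀ t : Finset (Fin n), ∏ i ∈ t, x i =
      if t ⊆ (Finset.univ.filter fun i => x i = 1) then 1 else 0 := by
    intro t
    split_ifs with ht
    · exact Finset.prod_eq_one fun i hi => (Finset.mem_filter.1 (ht hi)).2
    · obtain ⟨i, hi, hx⟩ := Finset.not_subset.1 ht
      refine Finset.prod_eq_zero hi ((zmod_two_cases _).resolve_right fun h => hx ?_)
      simpa using h
  rw [elemSym2, MvPolynomial.esymm, map_sum]
  simp only [map_prod, MvPolynomial.eval_X, h]
  rw [Finset.sum_ite, Finset.sum_const_zero, add_zero, Finset.sum_const, nsmul_one,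
    cubeWeight_eq_card, ← Finset.card_powersetCard]
  congr 2
  ext t
  simp only [Finset.mem_filter, Finset.mem_powersetCard, Finset.subset_univ, true_and]
  tauto

theorem totalDegree_esymm_le (n k : ℕ) :
    (MvPolynomial.esymm (Fin n) (ZMod 2) k).totalDegree ≤ k := by
  refine MvPolynomial.totalDegree_finsetSum_le fun t ht => ?_
  refine (MvPolynomial.totalDegree_finsetProd _ _).trans ?_
  simp [(Finset.mem_powersetCard.1 ht).2]

theorem totalDegree_elemSym1_le (n : ℕ) : (elemSym1 n).totalDegree ≤ 2 :=
  (totalDegree_esymm_le n 1).trans (by norm_num)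

theorem totalDegree_elemSym2_le (n : ℕ) : (elemSym2 n).totalDegree ≤ 2 :=
  totalDegree_esymm_le n 2

theorem totalDegree_elemSym2_add_elemSym1_le (n : ℕ) :
    (elemSym2 n + elemSym1 n).totalDegree ≤ 2 :=
  (MvPolynomial.totalDegree_add _ _).trans
    (max_le (totalDegree_elemSym2_le n) (totalDegree_elemSym1_le n))

theorem quadForm_single {n : ℕ} (U : Fin n → Fin n → ZMod 2) (i : Fin n) (a : ZMod 2) :
    quadForm U (Pi.single i a) = U i i * a := by
  rw [quadForm, Finset.sum_eq_single i, Finset.sum_eq_single i]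
  · rcases zmod_two_cases a with rfl | rfl <;> simp
  · intro j _ hj; simp [hj]
  · simp
  · intro j _ hj; simp [hj]
  · simp

/-- Over the field with two elements, a quadratic form with a symmetric matrix is linear. -/
theorem quadForm_of_symm {n : ℕ} (D : Fin n → Fin n → ZMod 2) (hD : ∀ i j, D i j = D j i)
    (x : Cube n) : quadForm D x = ∑ i, D i i * x i := by
  have hadd : ∀ x h, quadForm D (x + h) = quadForm D x + quadForm D h := fun x h => by
    rw [quadForm_add]
    have : ∀ i, polarMap D h i = 0 := fun i => Finset.sum_eq_zero fun j _ => by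
      rw [hD j i, add_self_zmod_two, zero_mul]
    simp [this]
  let φ : Cube n →+ ZMod 2 := AddMonoidHom.mk' (quadForm D) hadd
  have hx : x = ∑ i, Pi.single i (x i) := (Finset.univ_sum_single x).symm
  have : φ x = ∑ i, φ (Pi.single i (x i)) := by
    conv_lhs => rw [hx]
    exact map_sum φ _ _
  refine this.trans (Finset.sum_congr rfl fun i _ => quadForm_single D i (x i))

/-- A quadratic form in which every product `x_i x_j`, `i < j`, occurs is `e²` plus a linear
form. -/
theorem exists_quadForm_eq_choose_add {n : ℕ} (U : Fin n → Fin n → ZMod 2)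
    (hU : ∀ i j, i ≠ j → U i j + U j i = 1) :
    ∃ b : Fin n → ZMod 2, ∀ x,
      quadForm U x = ((cubeWeight x).choose 2 : ZMod 2) + ∑ i, b i * x i := by
  obtain ⟨c, V, hV⟩ := exists_quadForm_of_totalDegree_le_two _ (totalDegree_elemSym2_le n)
  simp only [eval_elemSym2] at hV
  have hc : c = 0 := by simpa [cubeWeight, quadForm] using (hV 0).symm
  subst hc
  simp only [zero_add] at hV
  have hVp : ∀ i j, i ≠ j → V i j + V j i = 1 := by
    intro i j hij
    have hsingle : ∀ i : Fin n, cubeWeight (Pi.single i (1 : ZMod 2) : Cube n) = 1 := fun i => by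
      rw [cubeWeight_eq_card, Finset.card_eq_one]
      refine ⟨i, ?_⟩
      ext k
      by_cases h : k = i
      · subst h; simp
      · simp [h]
    have hpair : cubeWeight (Pi.single i (1 : ZMod 2) + Pi.single j 1 : Cube n) = 2 := by
      rw [cubeWeight_eq_card, Finset.card_eq_two]
      refine ⟨i, j, hij, ?_⟩
      ext k
      by_cases h : k = i
      · subst h; simp [hij]
      · by_cases h' : k = j
        · subst h'; simp [h]
        · simp [h, h']
    have hi := hV (Pi.single i 1)
    have hj := hV (Pi.single j 1)
    have hp := hV (Pi.single i 1 + Pi.single j 1)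
    rw [hpair, quadForm_add, ← hi, ← hj, hsingle, hsingle, Finset.sum_eq_single i] at hp
    · have h1 : polarMap V (Pi.single j 1) i = V i j + V j i := by
        rw [polarMap, Finset.sum_eq_single j]
        · simp
        · intro k _ hk; simp [hk]
        · simp
      simpa [h1] using hp.symm
    · intro k _ hk; simp [hk]
    · simp
  refine ⟨fun i => U i i + V i i, fun x => ?_⟩
  have hsum : quadForm (fun i j => U i j + V i j) x = quadForm U x + quadForm V x := by
    simp only [quadForm, ← Finset.sum_add_distrib]
    exact Finset.sum_congr rfl fun i _ => Finset.sum_congr rfl fun j _ => by ring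
  rw [hV, ← quadForm_of_symm (fun i j => U i j + V i j) ?_, hsum]
  · linear_combination -add_self_zmod_two (quadForm V x)
  · intro i j
    by_cases hij : i = j
    · rw [hij]
    · linear_combination hU i j hij + hVp i j hij - add_self_zmod_two (U j i)
        - add_self_zmod_two (V j i) + add_self_zmod_two 1

theorem bitSign_choose_two (w : ℕ) : (bitSign (w.choose 2 : ZMod 2) : ℂ) =
    (1 - Complex.I) / 2 * Complex.I ^ w + (1 + Complex.I) / 2 * (-Complex.I) ^ w := by
  have hw : ∀ w : ℕ, (bitSign (w : ZMod 2) : ℂ) = (-1) ^ w := by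
    intro w
    induction w with
    | zero => simp [bitSign_zero]
    | succ w ih => rw [Nat.cast_succ, bitSign_add, bitSign_one]; push_cast; rw [ih]; ring
  induction w with
  | zero => simp [bitSign_zero]; ring
  | succ w ih =>
    rw [Nat.choose_succ_succ' w 1, Nat.choose_one_right, Nat.cast_add, bitSign_add]
    push_cast
    rw [ih, hw, mul_add, mul_left_comm, ← mul_pow, mul_left_comm, ← mul_pow, pow_succ, pow_succ]
    simp only [neg_mul, one_mul, neg_neg]
    linear_combination ((Complex.I ^ w) / 2 + (-Complex.I) ^ w / 2) * (Complex.I_sq)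

/-- The sign of `e²` is a combination of `i^w` and `(-i)^w`, so its twisted means, also after adding
a linear form, are sums of two products. -/
theorem twistedMean_choose_two_add {n : ℕ} (z : ℂ) (b : Fin n → ZMod 2) :
    twistedMean z (fun x : Cube n => ((cubeWeight x).choose 2 : ZMod 2) + ∑ i, b i * x i) =
      (1 - Complex.I) / 2 * ∏ i, ((1 + (bitSign (b i) : ℂ) * (Complex.I * z)) / 2) +
        (1 + Complex.I) / 2 * ∏ i, ((1 + (bitSign (b i) : ℂ) * (-Complex.I * z)) / 2) := by
  rw [← twistedMean_linear, ← twistedMean_linear, twistedMean, twistedMean, twistedMean,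
    ← mul_div_assoc, ← mul_div_assoc, ← add_div, Finset.mul_sum, Finset.mul_sum,
    ← Finset.sum_add_distrib]
  congr 1
  refine Finset.sum_congr rfl fun x _ => ?_
  rw [bitSign_add]
  push_cast
  rw [bitSign_choose_two, mul_pow, mul_pow]
  ring

theorem twistedMean_const_add {n : ℕ} (z : ℂ) (c : ZMod 2) (f : Cube n → ZMod 2) :
    twistedMean z (fun x => c + f x) = bitSign c * twistedMean z f := by
  rw [twistedMean, twistedMean, ← mul_div_assoc, Finset.mul_sum]
  congr 1
  refine Finset.sum_congr rfl fun x _ => ?_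
  rw [bitSign_add]
  push_cast
  ring

theorem norm_one_sub_I_div_two : ‖(1 - Complex.I) / 2‖ = 1 / √2 := by
  have h : ‖(1 - Complex.I)‖ = √2 := by
    rw [Complex.norm_eq_sqrt_sq_add_sq]; norm_num
  have h2 : √2 * √2 = (2 : ℝ) := Real.mul_self_sqrt (by norm_num)
  rw [norm_div, h, Complex.norm_ofNat]
  field_simp
  linarith

theorem norm_one_add_I_div_two : ‖(1 + Complex.I) / 2‖ = 1 / √2 := by
  have h : (1 + Complex.I) / 2 = (starRingEnd ℂ) ((1 - Complex.I) / 2) := by simp [map_ofNat]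
  rw [h, RCLike.norm_conj, norm_one_sub_I_div_two]

theorem norm_one_add_I_mul_div_two (z : ℂ) (hz : ‖z‖ = 1) :
    ‖(1 + Complex.I * z) / 2‖ = √((1 - z.im) / 2) := by
  have h1 : z.re * z.re + z.im * z.im = 1 := by
    rw [← Complex.normSq_apply, Complex.normSq_eq_norm_sq, hz]; norm_num
  rw [Complex.norm_def, Complex.normSq_apply]
  congr 1
  simp
  linear_combination h1 / 4

theorem norm_one_sub_I_mul_div_two (z : ℂ) (hz : ‖z‖ = 1) :
    ‖(1 + -Complex.I * z) / 2‖ = √((1 + z.im) / 2) := by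
  have := norm_one_add_I_mul_div_two (-z) (by simpa using hz)
  simpa using this

theorem prod_le_mul_pow_of_mem {n : ℕ} (f : Fin n → ℝ) (a : Fin n) {σ τ : ℝ} (hf : ∀ i, 0 ≤ f i)
    (hσ : ∀ i, f i ≤ σ) (ha : f a ≤ τ) : (∏ i, f i) * σ ≤ τ * σ ^ n := by
  have hσ0 : 0 ≤ σ := (hf a).trans (hσ a)
  have hn : n = (Finset.univ.erase a).card + 1 := by
    rw [Finset.card_erase_of_mem (Finset.mem_univ a), Finset.card_univ, Fintype.card_fin]
    have := a.pos
    omega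
  have h1 : ∏ i ∈ Finset.univ.erase a, f i ≤ σ ^ (Finset.univ.erase a).card :=
    (Finset.prod_le_prod (fun i _ => hf i) fun i _ => hσ i).trans_eq (Finset.prod_const σ)
  rw [← Finset.mul_prod_erase _ _ (Finset.mem_univ a)]
  calc _ ≤ τ * σ ^ (Finset.univ.erase a).card * σ := by
        refine mul_le_mul_of_nonneg_right (mul_le_mul ha h1 ?_ ((hf a).trans ha)) hσ0
        exact Finset.prod_nonneg fun i _ => hf i
    _ = τ * σ ^ n := by rw [mul_assoc, ← pow_succ, ← hn]

/-- For `e²` plus a nonconstant selection of the variables, each of the two products in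
`twistedMean_choose_two_add` contains a factor of the smaller modulus. -/
theorem norm_twistedMean_choose_two_add_le {n : ℕ} (z : ℂ) (hz : ‖z‖ = 1) (him : 0 ≤ z.im)
    (b : Fin n → ZMod 2) (i₀ i₁ : Fin n) (h0 : b i₀ = 0) (h1 : b i₁ = 1) :
    ‖twistedMean z (fun x : Cube n => ((cubeWeight x).choose 2 : ZMod 2) + ∑ i, b i * x i)‖ *
      √((1 + z.im) / 2) ≤ √2 * √((1 - z.im) / 2) * √((1 + z.im) / 2) ^ n := by
  set σ := √((1 + z.im) / 2) with hσ
  set τ := √((1 - z.im) / 2) with hτ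
  have hτσ : τ ≤ σ := Real.sqrt_le_sqrt (by linarith)
  have hneg : ∀ w : ℂ, 1 + (bitSign 1 : ℂ) * w = 1 + -w := fun w => by simp [bitSign_one]
  have hI : -(Complex.I * z) = -Complex.I * z := by ring
  have hI' : -(-Complex.I * z) = Complex.I * z := by ring
  have hA : (∏ i, ‖(1 + (bitSign (b i) : ℂ) * (Complex.I * z)) / 2‖) * σ ≤ τ * σ ^ n := by
    refine prod_le_mul_pow_of_mem _ i₀ (fun _ => norm_nonneg _) (fun i => ?_) ?_
    · rcases zmod_two_cases (b i) with h | h <;> rw [h]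
      · rw [bitSign_zero, Complex.ofReal_one, one_mul, norm_one_add_I_mul_div_two z hz]
        exact hτσ
      · rw [hneg, hI, norm_one_sub_I_mul_div_two z hz]
    · rw [h0, bitSign_zero, Complex.ofReal_one, one_mul, norm_one_add_I_mul_div_two z hz]
  have hB : (∏ i, ‖(1 + (bitSign (b i) : ℂ) * (-Complex.I * z)) / 2‖) * σ ≤ τ * σ ^ n := by
    refine prod_le_mul_pow_of_mem _ i₁ (fun _ => norm_nonneg _) (fun i => ?_) ?_
    · rcases zmod_two_cases (b i) with h | h <;> rw [h]
      · rw [bitSign_zero, Complex.ofReal_one, one_mul, norm_one_sub_I_mul_div_two z hz]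
      · rw [hneg, hI', norm_one_add_I_mul_div_two z hz]
        exact hτσ
    · rw [h1, hneg, hI', norm_one_add_I_mul_div_two z hz]
  have hs2 : 1 / √2 + 1 / √2 = √2 := by
    have h2 : √2 * √2 = (2 : ℝ) := Real.mul_self_sqrt (by norm_num)
    field_simp
    linarith
  rw [twistedMean_choose_two_add]
  calc _ ≤ (1 / √2 * (∏ i, ‖(1 + (bitSign (b i) : ℂ) * (Complex.I * z)) / 2‖) +
        1 / √2 * (∏ i, ‖(1 + (bitSign (b i) : ℂ) * (-Complex.I * z)) / 2‖)) * σ := by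
        refine mul_le_mul_of_nonneg_right ((norm_add_le _ _).trans_eq ?_) (Real.sqrt_nonneg _)
        rw [norm_mul, norm_mul, norm_prod, norm_prod, norm_one_sub_I_div_two,
          norm_one_add_I_div_two]
    _ = 1 / √2 * ((∏ i, ‖(1 + (bitSign (b i) : ℂ) * (Complex.I * z)) / 2‖) * σ) +
        1 / √2 * ((∏ i, ‖(1 + (bitSign (b i) : ℂ) * (-Complex.I * z)) / 2‖) * σ) := by ring
    _ ≤ 1 / √2 * (τ * σ ^ n) + 1 / √2 * (τ * σ ^ n) := by gcongr
    _ = √2 * τ * σ ^ n := by rw [← add_mul, hs2]; ring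

/-- Stability: for an angle with sine at least `0.86`, a quadratic polynomial that is not, up to a
constant, one of `e²` and `e² + e¹` has a twisted mean smaller than theirs by a fixed factor. -/
theorem exists_norm_twistedMean_le_or_symm (z : ℂ) (hz : ‖z‖ = 1) (him : 0.86 ≤ z.im) :
    ∃ β : ℝ, 0 ≤ β ∧ β < 1 / √2 ∧ ∀ᶠ n : ℕ in atTop, ∀ p : Poly2 n, p.totalDegree ≤ 2 →
      ‖twistedMean z (fun x : Cube n => MvPolynomial.eval x p)‖ ≤ β * √((1 + z.im) / 2) ^ n ∨
      ∃ c : ZMod 2, (∀ x, MvPolynomial.eval x p = c + MvPolynomial.eval x (elemSym2 n)) ∨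
        (∀ x, MvPolynomial.eval x p = c + MvPolynomial.eval x (elemSym2 n + elemSym1 n)) := by
  have h1 : z.re * z.re + z.im * z.im = 1 := by
    rw [← Complex.normSq_apply, Complex.normSq_eq_norm_sq, hz]; norm_num
  have hs1 : z.im ≤ 1 := by nlinarith [mul_self_nonneg z.re]
  have hs0 : 0 < z.im := by linarith
  have hre : |z.re| ≤ 0.511 := abs_le_of_sq_le_sq (by nlinarith) (by norm_num)
  set ρ := |z.re| / z.im with hρ
  have hρ0 : 0 ≤ ρ := by positivity
  have hρ1 : ρ ≤ 0.6 := by rw [hρ, div_le_iff₀ hs0]; linarith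
  obtain ⟨β, hβ0, hβ, hev⟩ := exists_pairSum_le hs0 hs1 (abs_nonneg z.re) hρ0 (by linarith)
    (by rw [hρ]; field_simp) (by rw [div_lt_iff₀ (by positivity)]; nlinarith)
  set σ := √((1 + z.im) / 2) with hσ
  set τ := √((1 - z.im) / 2) with hτ
  have hσ0 : 0 < σ := Real.sqrt_pos.2 (by linarith)
  have hτ2 : 2 * τ < σ := by
    have : 2 * τ = √(4 * ((1 - z.im) / 2)) := by
      rw [Real.sqrt_mul (by norm_num), show (4 : ℝ) = 2 ^ 2 by norm_num,
        Real.sqrt_sq (by norm_num)]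
    rw [this]
    exact Real.sqrt_lt_sqrt (by linarith) (by linarith)
  refine ⟨max √β (√2 * τ / σ), le_max_of_le_left (Real.sqrt_nonneg _), max_lt ?_ ?_, ?_⟩
  · rw [one_div, ← Real.sqrt_inv]
    exact Real.sqrt_lt_sqrt hβ0 (by linarith)
  · have h2 : √2 * √2 = (2 : ℝ) := Real.mul_self_sqrt (by norm_num)
    rw [div_lt_div_iff₀ hσ0 (by positivity)]
    linear_combination hτ2 + τ * h2
  filter_upwards [hev] with n hn p hp
  obtain ⟨c, U, hU⟩ := exists_quadForm_of_totalDegree_le_two p hp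
  by_cases hcomp : ∃ i j, i ≠ j ∧ U i j + U j i ≠ 1
  · left
    have h3 := normSq_twistedMean_le_pairSum z hz c U _ hU
    rw [abs_of_pos hs0] at h3
    have h4 := hn U hcomp
    have h5 : ‖twistedMean z (fun x : Cube n => MvPolynomial.eval x p)‖ ^ 2 ≤ (√β * σ ^ n) ^ 2 := by
      rw [mul_pow, Real.sq_sqrt hβ0, ← pow_mul, mul_comm n 2, pow_mul, hσ,
        Real.sq_sqrt (by linarith), div_pow]
      refine h3.trans ?_
      rw [← mul_div_assoc]
      gcongr
    refine (abs_le_of_sq_le_sq' h5 (by positivity)).2.trans ?_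
    gcongr
    exact le_max_left _ _
  · push Not at hcomp
    obtain ⟨b, hb⟩ := exists_quadForm_eq_choose_add U hcomp
    by_cases hb0 : ∀ i, b i = 0
    · right
      exact ⟨c, Or.inl fun x => by rw [hU, hb, eval_elemSym2]; simp [hb0]⟩
    by_cases hb1 : ∀ i, b i = 1
    · right
      exact ⟨c, Or.inr fun x => by rw [hU, hb, map_add, eval_elemSym2, eval_elemSym1]; simp [hb1]⟩
    left
    push Not at hb0 hb1
    obtain ⟨i₁, hi₁⟩ := hb0
    obtain ⟨i₀, hi₀⟩ := hb1
    have h6 := norm_twistedMean_choose_two_add_le z hz hs0.le b i₀ i₁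
      ((zmod_two_cases _).resolve_right hi₀) ((zmod_two_cases _).resolve_left hi₁)
    have h7 : (fun x : Cube n => MvPolynomial.eval x p) = fun x =>
        c + (((cubeWeight x).choose 2 : ZMod 2) + ∑ i, b i * x i) :=
      funext fun x => by rw [hU, hb]
    rw [h7, twistedMean_const_add, norm_mul, Complex.norm_real, Real.norm_eq_abs, abs_bitSign,
      one_mul]
    have h8 := (le_div_iff₀ hσ0).2 h6
    refine h8.trans ?_
    rw [mul_div_right_comm]
    gcongr
    exact le_max_right _ _

/-! ### Angles that are multiples of `2π / m` -/

/-- The root of unity `exp (2π i ℓ / m)`. -/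
noncomputable def unitRoot (m ℓ : ℕ) : ℂ := Complex.exp (2 * Real.pi * Complex.I / m) ^ ℓ

theorem unitRoot_eq_exp (m ℓ : ℕ) :
    unitRoot m ℓ = Complex.exp (((ℓ : ℝ) * (2 * Real.pi / m) : ℝ) * Complex.I) := by
  rw [unitRoot, ← Complex.exp_nat_mul]
  congr 1
  push_cast
  ring

theorem norm_unitRoot (m ℓ : ℕ) : ‖unitRoot m ℓ‖ = 1 := by
  rw [unitRoot_eq_exp, Complex.norm_exp_ofReal_mul_I]

theorem unitRoot_re (m ℓ : ℕ) : (unitRoot m ℓ).re = Real.cos (ℓ * (2 * Real.pi / m)) := by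
  rw [unitRoot_eq_exp, Complex.exp_ofReal_mul_I_re]

theorem unitRoot_im (m ℓ : ℕ) : (unitRoot m ℓ).im = Real.sin (ℓ * (2 * Real.pi / m)) := by
  rw [unitRoot_eq_exp, Complex.exp_ofReal_mul_I_im]

theorem unitRoot_zero (m : ℕ) : unitRoot m 0 = 1 := pow_zero _

theorem unitRoot_sub {m ℓ : ℕ} (hm : 0 < m) (hℓ : ℓ ≤ m) :
    unitRoot m (m - ℓ) = (starRingEnd ℂ) (unitRoot m ℓ) := by
  have h1 : unitRoot m (m - ℓ) * unitRoot m ℓ = 1 := by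
    rw [unitRoot, unitRoot, ← pow_add, Nat.sub_add_cancel hℓ]
    exact (Complex.isPrimitiveRoot_exp m hm.ne').pow_eq_one
  have h2 : (starRingEnd ℂ) (unitRoot m ℓ) * unitRoot m ℓ = 1 := by
    rw [mul_comm, Complex.mul_conj, Complex.normSq_eq_norm_sq, norm_unitRoot]; norm_num
  have h0 : unitRoot m ℓ ≠ 0 := fun h => by simp [h] at h2
  exact mul_right_cancel₀ h0 (h1.trans h2.symm)

theorem sum_unitRoot_pow {m : ℕ} (hm : 0 < m) (w : ℕ) :
    ∑ ℓ ∈ Finset.range m, unitRoot m ℓ ^ w = if m ∣ w then (m : ℂ) else 0 := by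
  have hζ := Complex.isPrimitiveRoot_exp m hm.ne'
  set ζ := Complex.exp (2 * Real.pi * Complex.I / m) with hζdef
  have h : ∀ ℓ, unitRoot m ℓ ^ w = (ζ ^ w) ^ ℓ := fun ℓ => by
    rw [unitRoot, ← hζdef, ← pow_mul, ← pow_mul, mul_comm]
  simp only [h]
  split_ifs with hw
  · rw [(hζ.pow_eq_one_iff_dvd w).2 hw]; simp
  · have h1 : ζ ^ w - 1 ≠ 0 := sub_ne_zero.2 fun e => hw ((hζ.pow_eq_one_iff_dvd w).1 e)
    refine (mul_eq_zero.1 ?_).resolve_right h1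
    rw [geom_sum_mul, ← pow_mul, mul_comm w m, pow_mul, hζ.pow_eq_one, one_pow, sub_self]

/-- Among the multiples of `π / 2m`, the largest values of `|cos|` below `cos (π / 2m)` are
`cos (π / m)`. -/
theorem abs_cos_int_mul_le {m : ℕ} (hm : 0 < m) {k : ℤ} (h0 : ¬ (2 * m : ℤ) ∣ k)
    (h1 : ¬ (2 * m : ℤ) ∣ k - 1) (h2 : ¬ (2 * m : ℤ) ∣ k + 1) :
    |Real.cos (k * (Real.pi / (2 * m)))| ≤ Real.cos (Real.pi / m) := by
  have hm' : (0 : ℝ) < m := by exact_mod_cast hm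
  obtain ⟨r, t, hk, hr1, hr2⟩ : ∃ r t : ℤ, k = r + 2 * m * t ∧ -(m : ℤ) ≤ r ∧ r ≤ m := by
    have e := Int.bmod_add_bdiv k (2 * m)
    have b1 := Int.le_bmod (x := k) (m := 2 * m) (by omega)
    have b2 := Int.bmod_lt (x := k) (m := 2 * m) (by omega)
    push_cast at e b1 b2
    exact ⟨k.bmod (2 * m), k.bdiv (2 * m), e.symm, by omega, by omega⟩
  have hr : 2 ≤ |r| := by
    by_contra hcon
    have : r = 0 ∨ r = 1 ∨ r = -1 := by
      have := abs_lt.1 (not_le.1 hcon)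
      omega
    rcases this with rfl | rfl | rfl
    · exact h0 ⟨t, by rw [hk]; ring⟩
    · exact h1 ⟨t, by rw [hk]; ring⟩
    · exact h2 ⟨t, by rw [hk]; ring⟩
  have hrm : |r| ≤ m := abs_le.2 ⟨hr1, hr2⟩
  have hr' : (2 : ℝ) ≤ |(r : ℝ)| := by exact_mod_cast hr
  have hrm' : |(r : ℝ)| ≤ m := by exact_mod_cast hrm
  have hpi := Real.pi_pos
  have e : (k : ℝ) * (Real.pi / (2 * m)) = r * (Real.pi / (2 * m)) + t * Real.pi := by
    rw [hk]; push_cast; field_simp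
  have habs : |(r : ℝ) * (Real.pi / (2 * m))| = |(r : ℝ)| * (Real.pi / (2 * m)) := by
    rw [abs_mul, abs_of_pos (show 0 < Real.pi / (2 * m) by positivity)]
  have hup : |(r : ℝ)| * (Real.pi / (2 * m)) ≤ Real.pi / 2 := by
    calc _ ≤ (m : ℝ) * (Real.pi / (2 * m)) := by gcongr
      _ = Real.pi / 2 := by field_simp
  rw [e, Real.cos_add_int_mul_pi, abs_mul, abs_neg_one_zpow, one_mul, ← Real.cos_abs, habs,
    abs_of_nonneg (Real.cos_nonneg_of_neg_pi_div_two_le_of_le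
      (by have : 0 ≤ |(r : ℝ)| * (Real.pi / (2 * m)) := by positivity
          linarith) hup)]
  refine Real.cos_le_cos_of_nonneg_of_le_pi (by positivity) (by linarith) ?_
  calc Real.pi / m = 2 * (Real.pi / (2 * m)) := by field_simp
    _ ≤ _ := by gcongr

/-- `L` is the integer closest to `m / 4` for odd `m`, and `ε = 4 L - m` is `1` or `-1`. -/
structure NearestQuarter (m L : ℕ) (ε : ℤ) : Prop where
  three_le : 3 ≤ m
  odd : Odd m
  sign : ε = 1 ∨ ε = -1
  four_mul : 4 * (L : ℤ) = m + ε

theorem abs_cos_le_of_ne_zero {m ℓ : ℕ} (hm : 3 ≤ m) (hodd : Odd m) (h0 : ℓ ≠ 0) (hℓ : ℓ < m) :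
    |Real.cos (ℓ * (2 * Real.pi / m))| ≤ Real.cos (Real.pi / m) := by
  have hm' : (m : ℝ) ≠ 0 := by positivity
  have e : (ℓ : ℝ) * (2 * Real.pi / m) = ((4 * ℓ : ℤ) : ℝ) * (Real.pi / (2 * m)) := by
    push_cast; field_simp; ring
  rw [e]
  refine abs_cos_int_mul_le (by omega) ?_ ?_ ?_
  · rintro ⟨t, ht⟩
    have hdvd : (m : ℤ) ∣ 2 * ℓ := ⟨t, by linarith⟩
    have hdvd' : m ∣ 2 * ℓ := by exact_mod_cast hdvd
    have := (Nat.Coprime.dvd_mul_left (Nat.Coprime.symm (Nat.coprime_two_left.2 hodd))).1 hdvd'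
    exact h0 (Nat.eq_zero_of_dvd_of_lt this hℓ)
  · rintro ⟨t, ht⟩
    have : (4 * ℓ : ℤ) - 1 = 2 * (m * t) := by linarith
    omega
  · rintro ⟨t, ht⟩
    have : (4 * ℓ : ℤ) + 1 = 2 * (m * t) := by linarith
    omega

theorem NearestQuarter.abs_sin_le {m L ℓ : ℕ} {ε : ℤ} (h : NearestQuarter m L ε)
    (hℓ : ℓ < m) (h1 : ℓ ≠ L) (h2 : ℓ ≠ m - L) :
    |Real.sin (ℓ * (2 * Real.pi / m))| ≤ Real.cos (Real.pi / m) := by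
  obtain ⟨hm, hodd, hε, hL⟩ := h
  have hm' : (m : ℝ) ≠ 0 := by positivity
  have e : Real.pi / 2 - (ℓ : ℝ) * (2 * Real.pi / m) =
      ((m - 4 * ℓ : ℤ) : ℝ) * (Real.pi / (2 * m)) := by
    push_cast; field_simp; ring
  obtain ⟨q, hq⟩ := hodd
  have hcop : ∀ a : ℤ, (m : ℤ) ∣ 2 * a → (m : ℤ) ∣ a := fun a ha =>
    (Int.isCoprime_iff_gcd_eq_one.2 (by
      have := Nat.coprime_two_right.2 (⟨q, hq⟩ : Odd m)
      exact_mod_cast this)).dvd_of_dvd_mul_left ha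
  -- A multiple of `m` in the ranges of `ℓ - L` and `ℓ + L` is `0`, respectively `m`.
  have hA : ¬ (m : ℤ) ∣ ℓ - L := fun hd => by
    have : ((ℓ : ℤ) - L) = 0 := Int.eq_zero_of_abs_lt_dvd hd (abs_lt.2 ⟨by omega, by omega⟩)
    omega
  have hB : ¬ (m : ℤ) ∣ ℓ + L := fun hd => by
    have hd' : (m : ℤ) ∣ ℓ + L - m := hd.sub (dvd_refl _)
    have : ((ℓ : ℤ) + L - m) = 0 := Int.eq_zero_of_abs_lt_dvd hd' (abs_lt.2 ⟨by omega, by omega⟩)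
    omega
  rw [← Real.cos_pi_div_two_sub, e]
  refine abs_cos_int_mul_le (by omega) ?_ ?_ ?_
  · rintro ⟨t, ht⟩
    have : (m - 4 * ℓ : ℤ) = 2 * (m * t) := by linarith
    omega
  · rintro ⟨t, ht⟩
    rcases hε with rfl | rfl
    · refine hB (hcop _ ⟨1 - t, by linarith⟩)
    · refine hA (hcop _ ⟨-t, by linarith⟩)
  · rintro ⟨t, ht⟩
    rcases hε with rfl | rfl
    · refine hA (hcop _ ⟨-t, by linarith⟩)
    · refine hB (hcop _ ⟨1 - t, by linarith⟩)

theorem exists_nearestQuarter {m : ℕ} (hm : 3 ≤ m) (hodd : Odd m) :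
    ∃ (L : ℕ) (ε : ℤ), NearestQuarter m L ε ∧ ellOne m = L ∧ (m ≡ 3 [MOD 4] → ε = 1) ∧
      (m ≡ 1 [MOD 4] → ε = -1) := by
  have hround : ∀ (L : ℕ) (ε : ℤ), (ε = 1 ∨ ε = -1) → 4 * (L : ℤ) = m + ε → ellOne m = L := by
    intro L ε hε hL
    have hL' : 4 * (L : ℝ) = m + ε := by exact_mod_cast hL
    rw [ellOne, round_eq, Int.floor_eq_iff]
    rcases hε with rfl | rfl <;> push_cast at hL' ⊢ <;> constructor <;> linarith
  have hcase : m % 4 = 1 ∨ m % 4 = 3 := by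
    obtain ⟨q, hq⟩ := hodd
    omega
  rcases hcase with h | h
  · have hL : 4 * ((m / 4 : ℕ) : ℤ) = m + -1 := by omega
    exact ⟨m / 4, -1, ⟨hm, hodd, Or.inr rfl, hL⟩, hround _ _ (Or.inr rfl) hL,
      fun h' => by rw [Nat.ModEq] at h'; omega, fun _ => rfl⟩
  · have hL : 4 * ((m / 4 + 1 : ℕ) : ℤ) = m + 1 := by omega
    exact ⟨m / 4 + 1, 1, ⟨hm, hodd, Or.inl rfl, hL⟩, hround _ _ (Or.inl rfl) hL,
      fun _ => rfl, fun h' => by rw [Nat.ModEq] at h'; omega⟩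

/-! ### From Boolean correlations to twisted means -/

theorem twistedMean_conj {n : ℕ} (z : ℂ) (f : Cube n → ZMod 2) :
    twistedMean ((starRingEnd ℂ) z) f = (starRingEnd ℂ) (twistedMean z f) := by
  simp [twistedMean, map_sum, map_ofNat]

/-- The contribution of the weights divisible by `m` to the mean of `(-1)^f`. -/
noncomputable def dvdMean (m : ℕ) {n : ℕ} (f : Cube n → ZMod 2) : ℝ :=
  (∑ x ∈ Finset.univ.filter fun x : Cube n => m ∣ cubeWeight x, bitSign (f x)) / 2 ^ n

theorem mul_dvdMean {m n : ℕ} (hm : 0 < m) (f : Cube n → ZMod 2) :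
    m * dvdMean m f = ∑ ℓ ∈ Finset.range m, (twistedMean (unitRoot m ℓ) f).re := by
  have h : ((m * dvdMean m f : ℝ) : ℂ) = ∑ ℓ ∈ Finset.range m, twistedMean (unitRoot m ℓ) f := by
    simp only [twistedMean]
    rw [← Finset.sum_div, Finset.sum_comm, dvdMean]
    push_cast
    rw [← mul_div_assoc, Finset.mul_sum, Finset.sum_filter]
    congr 1
    refine Finset.sum_congr rfl fun x _ => ?_
    rw [← Finset.mul_sum, sum_unitRoot_pow hm]
    split_ifs <;> ring
  rw [← Complex.re_sum, ← h, Complex.ofReal_re]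

theorem abs_le_one_of_twistedMean_one {n : ℕ} (f : Cube n → ZMod 2) :
    ‖twistedMean 1 f‖ ≤ 1 := by
  rw [twistedMean, norm_div, div_le_one (by simp)]
  refine (norm_sum_le _ _).trans ?_
  simp [abs_bitSign, Cube]

/-- The Boolean correlation in terms of `dvdMean`; the assumptions say that weights of both kinds
occur, so that neither mean in the definition is over the empty set. -/
theorem boolCorr_eq {m n : ℕ} (p : Poly2 n) (h0 : 0 < dvdMean m (0 : Cube n → ZMod 2))
    (h1 : dvdMean m (0 : Cube n → ZMod 2) < 1) :
    boolCorr m p = |dvdMean m (fun x => MvPolynomial.eval x p) -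
      dvdMean m (0 : Cube n → ZMod 2) * (twistedMean 1 fun x => MvPolynomial.eval x p).re| /
        (dvdMean m (0 : Cube n → ZMod 2) * (1 - dvdMean m (0 : Cube n → ZMod 2))) := by
  set f : Cube n → ZMod 2 := fun x => MvPolynomial.eval x p with hf
  set A := Finset.univ.filter fun x : Cube n => m ∣ cubeWeight x with hA
  set B := Finset.univ.filter fun x : Cube n => ¬ m ∣ cubeWeight x with hB
  have hA' : (Finset.univ : Finset (Cube n)).filter (fun x => boolMod m x = 0) = A := by
    ext x; simp [hA, boolMod]
  have hB' : (Finset.univ : Finset (Cube n)).filter (fun x => boolMod m x = 1) = B := by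
    ext x; simp [hB, boolMod]
  have ha : dvdMean m (0 : Cube n → ZMod 2) = A.card / 2 ^ n := by
    simp [dvdMean, bitSign_zero, hA]
  have hcard : (A.card : ℝ) + B.card = 2 ^ n := by
    have := Finset.card_filter_add_card_filter_not
      (s := (Finset.univ : Finset (Cube n))) (fun x => m ∣ cubeWeight x)
    rw [Finset.card_univ, Fintype.card_fun, ZMod.card, Fintype.card_fin] at this
    exact_mod_cast this
  have he : (twistedMean 1 f).re = (∑ x ∈ A, bitSign (f x) + ∑ x ∈ B, bitSign (f x)) / 2 ^ n := by
    rw [hA, hB, Finset.sum_filter_add_sum_filter_not]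
    have : twistedMean 1 f = (((∑ x, bitSign (f x)) / 2 ^ n : ℝ) : ℂ) := by
      simp [twistedMean]
    rw [this, Complex.ofReal_re]
  have hd : dvdMean m f = (∑ x ∈ A, bitSign (f x)) / 2 ^ n := rfl
  have h2 : (0 : ℝ) < 2 ^ n := by positivity
  rw [ha] at h0 h1 ⊢
  have hApos : (0 : ℝ) < A.card := by
    by_contra hcon
    exact absurd h0 (not_lt.2 (div_nonpos_of_nonpos_of_nonneg (not_lt.1 hcon) h2.le))
  have hBpos : (0 : ℝ) < B.card := by
    rw [div_lt_one h2] at h1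
    linarith
  rw [boolCorr, hA', hB', Finset.expect_eq_sum_div_card, Finset.expect_eq_sum_div_card, he, hd]
  change |(∑ x ∈ A, bitSign (f x)) / (A.card : ℝ) - (∑ x ∈ B, bitSign (f x)) / (B.card : ℝ)| = _
  set S := ∑ x ∈ A, bitSign (f x)
  set T := ∑ x ∈ B, bitSign (f x)
  rw [← hcard]
  have hAB : (0 : ℝ) < A.card + B.card := by positivity
  have hden : 0 < (A.card : ℝ) / (A.card + B.card) * (1 - (A.card : ℝ) / (A.card + B.card)) := by
    rw [one_sub_div hAB.ne', add_sub_cancel_left]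
    positivity
  rw [eq_div_iff hden.ne', ← abs_of_pos hden, ← abs_mul]
  congr 1
  field_simp
  ring

theorem one_add_cos_pi_div {m : ℕ} :
    (1 + Real.cos (Real.pi / m)) / 2 = Real.cos (Real.pi / (2 * m)) ^ 2 := by
  rw [Real.cos_sq]
  have : 2 * (Real.pi / (2 * m)) = Real.pi / m := by ring
  rw [this]
  ring

theorem cos_pi_div_two_mul_pos {m : ℕ} (hm : 3 ≤ m) : 0 < Real.cos (Real.pi / (2 * m)) := by
  have hm' : (3 : ℝ) ≤ m := by exact_mod_cast hm
  have hpi := Real.pi_pos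
  refine Real.cos_pos_of_mem_Ioo ⟨?_, ?_⟩
  · have : 0 < Real.pi / (2 * m) := by positivity
    linarith
  · exact div_lt_div_of_pos_left hpi (by norm_num) (by linarith)

theorem norm_twistedMean_le_cos_pow {m n ℓ : ℕ} (hm : 3 ≤ m)
    (hcos : |Real.cos (ℓ * (2 * Real.pi / m))| ≤ Real.cos (Real.pi / m))
    (hsin : |Real.sin (ℓ * (2 * Real.pi / m))| ≤ Real.cos (Real.pi / m))
    (p : Poly2 n) (hp : p.totalDegree ≤ 2) :
    ‖twistedMean (unitRoot m ℓ) (fun x : Cube n => MvPolynomial.eval x p)‖ ≤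
      Real.cos (Real.pi / (2 * m)) ^ n := by
  have h := norm_twistedMean_sq_le (unitRoot m ℓ) (norm_unitRoot m ℓ)
    (t := Real.cos (Real.pi / m)) (by rw [unitRoot_re]; exact hcos)
    (by rw [unitRoot_im]; exact hsin) p hp
  rw [one_add_cos_pi_div, ← pow_mul, mul_comm 2 n, pow_mul] at h
  exact (abs_le_of_sq_le_sq' h (pow_nonneg (cos_pi_div_two_mul_pos hm).le n)).2

/-- The linear polynomials `0` and `e¹` have small twisted means at all nontrivial angles. -/
theorem norm_twistedMean_const_mul_sum_le {m n ℓ : ℕ} (hm : 3 ≤ m) (hodd : Odd m) (h0 : ℓ ≠ 0)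
    (hℓ : ℓ < m) (b : ZMod 2) :
    ‖twistedMean (unitRoot m ℓ) (fun x : Cube n => ∑ i, b * x i)‖ ≤
      Real.cos (Real.pi / (2 * m)) ^ n := by
  rw [twistedMean_linear (unitRoot m ℓ) (fun _ => b), Finset.prod_const, Finset.card_univ,
    Fintype.card_fin, norm_pow]
  refine pow_le_pow_left₀ (norm_nonneg _) ?_ n
  have hc := abs_le.1 (abs_cos_le_of_ne_zero hm hodd h0 hℓ)
  rw [← unitRoot_re] at hc
  have h1 : (unitRoot m ℓ).re * (unitRoot m ℓ).re + (unitRoot m ℓ).im * (unitRoot m ℓ).im = 1 := by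
    rw [← Complex.normSq_apply, Complex.normSq_eq_norm_sq, norm_unitRoot]; norm_num
  have hsq : ‖(1 + (bitSign b : ℂ) * unitRoot m ℓ) / 2‖ ^ 2 ≤ Real.cos (Real.pi / (2 * m)) ^ 2 := by
    rw [← one_add_cos_pi_div, ← Complex.normSq_eq_norm_sq, Complex.normSq_apply]
    rcases zmod_two_cases b with rfl | rfl
    · simp [bitSign_zero]
      nlinarith
    · simp [bitSign_one]
      nlinarith
  exact (abs_le_of_sq_le_sq' hsq (cos_pi_div_two_mul_pos hm).le).2

/-- Expanding the indicator of `m ∣ w` over the `m`-th roots of unity, all terms but those at the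
angles `0` and `±ℓ₁ φ` are negligible; the terms at `ℓ₁ φ` and `-ℓ₁ φ` are conjugate. -/
theorem NearestQuarter.abs_mul_dvdMean_sub_le {m L n : ℕ} {ε : ℤ} (h : NearestQuarter m L ε)
    (p : Poly2 n) (hp : p.totalDegree ≤ 2) :
    |m * dvdMean m (fun x => MvPolynomial.eval x p) -
        (twistedMean 1 fun x => MvPolynomial.eval x p).re -
        2 * (twistedMean (unitRoot m L) fun x => MvPolynomial.eval x p).re| ≤
      m * Real.cos (Real.pi / (2 * m)) ^ n := by
  have hm := h.three_le
  have hL4 := h.four_mul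
  have hε := h.sign
  set f : Cube n → ZMod 2 := fun x => MvPolynomial.eval x p with hf
  set s := Real.cos (Real.pi / (2 * m)) with hs
  have hs0 : 0 < s := cos_pi_div_two_mul_pos hm
  obtain ⟨q, hq⟩ := h.odd
  have hL1 : 1 ≤ L := by omega
  have hLm : L < m := by omega
  have hne : L ≠ m - L := by omega
  have hsub : ({0, L, m - L} : Finset ℕ) ⊆ Finset.range m := by
    intro ℓ hℓ
    simp only [Finset.mem_insert, Finset.mem_singleton] at hℓ
    rw [Finset.mem_range]
    omega
  have hsum3 : ∑ ℓ ∈ ({0, L, m - L} : Finset ℕ), (twistedMean (unitRoot m ℓ) f).re =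
      (twistedMean 1 f).re + 2 * (twistedMean (unitRoot m L) f).re := by
    rw [Finset.sum_insert (by simp; omega), Finset.sum_pair hne, unitRoot_zero,
      unitRoot_sub (by omega) hLm.le, twistedMean_conj, Complex.conj_re]
    ring
  rw [mul_dvdMean (by omega), ← Finset.sum_sdiff hsub, hsum3]
  have hcancel : ∀ A B C : ℝ, A + (B + 2 * C) - B - 2 * C = A := fun A B C => by ring
  rw [hcancel]
  refine (Finset.abs_sum_le_sum_abs _ _).trans ?_
  calc _ ≤ ∑ ℓ ∈ Finset.range m \ {0, L, m - L}, s ^ n := by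
        refine Finset.sum_le_sum fun ℓ hℓ => ?_
        simp only [Finset.mem_sdiff, Finset.mem_range, Finset.mem_insert, Finset.mem_singleton,
          not_or] at hℓ
        obtain ⟨h1, h2, h3, h4⟩ := hℓ
        exact (Complex.abs_re_le_norm _).trans (norm_twistedMean_le_cos_pow hm
          (abs_cos_le_of_ne_zero hm h.odd h2 h1) (h.abs_sin_le h1 h3 h4) p hp)
    _ ≤ m * s ^ n := by
        rw [Finset.sum_const, nsmul_eq_mul]
        gcongr
        exact (Finset.card_le_card Finset.sdiff_subset).trans (Finset.card_range m).le

theorem NearestQuarter.abs_mul_dvdMean_zero_sub_one_le {m L n : ℕ} {ε : ℤ}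
    (h : NearestQuarter m L ε) :
    |m * dvdMean m (0 : Cube n → ZMod 2) - 1| ≤ 2 * m * Real.cos (Real.pi / (2 * m)) ^ n := by
  have hm := h.three_le
  have hL4 := h.four_mul
  have hε := h.sign
  have h1 := h.abs_mul_dvdMean_sub_le (0 : Poly2 n) (by simp)
  have h2 := norm_twistedMean_const_mul_sum_le (n := n) (ℓ := L) hm h.odd (by omega) (by omega) 0
  have h3 := (Complex.abs_re_le_norm _).trans h2
  have e0 : (fun x : Cube n => MvPolynomial.eval x (0 : Poly2 n)) = 0 := by
    funext x; simp
  have e1 : (fun x : Cube n => ∑ i, (0 : ZMod 2) * x i) = 0 := by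
    funext x; simp
  have e2 : twistedMean 1 (0 : Cube n → ZMod 2) = 1 := by
    simp [twistedMean, bitSign_zero, Cube]
  rw [e0, e2, Complex.one_re] at h1
  rw [e1] at h3
  set s := Real.cos (Real.pi / (2 * m)) with hs
  have hs0 : 0 < s ^ n := pow_pos (cos_pi_div_two_mul_pos hm) n
  have hm' : (3 : ℝ) ≤ m := by exact_mod_cast hm
  rw [abs_le] at h1 h3 ⊢
  constructor <;> nlinarith

/-- The modulus `√((1 + sin θ) / 2)`, `θ = ℓ₁ φ`, of the dominant factor of the twisted mean of
`e²` at the angle `θ`; here `sin θ = cos (π / 2m)`. -/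
noncomputable def mainRate (m : ℕ) : ℝ := √((1 + Real.cos (Real.pi / (2 * m))) / 2)

theorem cos_pi_div_two_mul_lt_one {m : ℕ} (hm : 3 ≤ m) : Real.cos (Real.pi / (2 * m)) < 1 := by
  have hm' : (3 : ℝ) ≤ m := by exact_mod_cast hm
  have hpi := Real.pi_pos
  rw [← Real.cos_zero]
  refine Real.cos_lt_cos_of_nonneg_of_le_pi le_rfl ?_ (by positivity)
  exact div_le_self hpi.le (by linarith)

theorem cos_lt_mainRate {m : ℕ} (hm : 3 ≤ m) : Real.cos (Real.pi / (2 * m)) < mainRate m := by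
  have h0 := cos_pi_div_two_mul_pos hm
  have h1 := cos_pi_div_two_mul_lt_one hm
  exact Real.lt_sqrt_of_sq_lt (by nlinarith)

theorem mainRate_pos {m : ℕ} (hm : 3 ≤ m) : 0 < mainRate m :=
  (cos_pi_div_two_mul_pos hm).trans (cos_lt_mainRate hm)

theorem NearestQuarter.angle_eq {m L : ℕ} {ε : ℤ} (h : NearestQuarter m L ε) :
    (L : ℝ) * (2 * Real.pi / m) = Real.pi / 2 + 2 * (ε * (Real.pi / (4 * m))) := by
  have hL : 4 * (L : ℝ) = m + ε := by exact_mod_cast h.four_mul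
  have hm' : (m : ℝ) ≠ 0 := by have := h.three_le; positivity
  have hL' : (L : ℝ) = (m + ε) / 4 := by linarith
  rw [hL']
  field_simp
  ring

theorem NearestQuarter.sin_angle {m L : ℕ} {ε : ℤ} (h : NearestQuarter m L ε) :
    Real.sin (L * (2 * Real.pi / m)) = Real.cos (Real.pi / (2 * m)) := by
  rw [h.angle_eq, add_comm, Real.sin_add_pi_div_two]
  have e : (2 : ℝ) * (Real.pi / (4 * m)) = Real.pi / (2 * m) := by ring
  rcases h.sign with rfl | rfl
  · push_cast; rw [one_mul, e]
  · push_cast; rw [neg_one_mul, mul_neg, Real.cos_neg, e]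

theorem NearestQuarter.abs_re_twistedMean_le {m L n : ℕ} {ε : ℤ} (h : NearestQuarter m L ε)
    (p : Poly2 n) (hp : p.totalDegree ≤ 2) :
    |(twistedMean (unitRoot m L) fun x => MvPolynomial.eval x p).re| ≤ mainRate m ^ n := by
  have hm := h.three_le
  have hL4 := h.four_mul
  have hε := h.sign
  have hcs : Real.cos (Real.pi / m) ≤ Real.cos (Real.pi / (2 * m)) := by
    have hpi := Real.pi_pos
    have hm' : (3 : ℝ) ≤ m := by exact_mod_cast hm
    refine Real.cos_le_cos_of_nonneg_of_le_pi (by positivity) ?_ ?_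
    · exact div_le_self hpi.le (by linarith)
    · exact div_le_div_of_nonneg_left hpi.le (by positivity) (by linarith)
  have h1 := norm_twistedMean_sq_le (unitRoot m L) (norm_unitRoot m L)
    (t := Real.cos (Real.pi / (2 * m)))
    (by rw [unitRoot_re]
        exact (abs_cos_le_of_ne_zero hm h.odd (by omega) (by omega)).trans hcs)
    (by rw [unitRoot_im, h.sin_angle, abs_of_pos (cos_pi_div_two_mul_pos hm)]) p hp
  have h2 : ((1 + Real.cos (Real.pi / (2 * m))) / 2) ^ n = (mainRate m ^ n) ^ 2 := by
    rw [← pow_mul, mul_comm n 2, pow_mul, mainRate, Real.sq_sqrt]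
    have := cos_pi_div_two_mul_pos hm
    linarith
  rw [h2] at h1
  exact (Complex.abs_re_le_norm _).trans
    (abs_le_of_sq_le_sq' h1 (pow_nonneg (mainRate_pos hm).le n)).2

/-- Uniformly in the quadratic polynomial, the Boolean correlation is governed by the real part of
the twisted mean at the angle closest to a right angle. -/
theorem NearestQuarter.abs_boolCorr_sub_le {m L : ℕ} {ε : ℤ} (h : NearestQuarter m L ε) {δ : ℝ}
    (hδ : 0 < δ) : ∀ᶠ n : ℕ in atTop, ∀ p : Poly2 n, p.totalDegree ≤ 2 →
      |boolCorr m p - 2 * (m : ℝ) / ((m : ℝ) - 1) *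
        abs (twistedMean (unitRoot m L) fun x => MvPolynomial.eval x p).re| ≤
        δ * mainRate m ^ n := by
  have hm := h.three_le
  have hm' : (3 : ℝ) ≤ m := by exact_mod_cast hm
  have hm0 : (0 : ℝ) < m := by linarith
  set s := Real.cos (Real.pi / (2 * m)) with hs
  set σ := mainRate m with hσ
  have hs0 : 0 < s := cos_pi_div_two_mul_pos hm
  have hs1 : s < 1 := cos_pi_div_two_mul_lt_one hm
  have hsσ : s < σ := cos_lt_mainRate hm
  have hσ0 : 0 < σ := mainRate_pos hm
  set a : ℕ → ℝ := fun n => dvdMean m (0 : Cube n → ZMod 2) with ha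
  have hma : Tendsto (fun n => m * a n) atTop (𝓝 1) := by
    rw [tendsto_iff_dist_tendsto_zero]
    refine squeeze_zero (fun _ => dist_nonneg)
      (fun n => (Real.dist_eq _ _).trans_le h.abs_mul_dvdMean_zero_sub_one_le) ?_
    simpa using (tendsto_pow_atTop_nhds_zero_of_lt_one hs0.le hs1).const_mul (2 * (m : ℝ))
  have hlim : Tendsto a atTop (𝓝 (1 / m)) := by
    have := hma.div_const (m : ℝ)
    refine this.congr fun n => ?_
    field_simp
  have hm1 : (1 : ℝ) / m < 1 := by rw [div_lt_one hm0]; linarith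
  set D : ℕ → ℝ := fun n => 1 / (m * a n * (1 - a n)) with hD
  have hDlim : Tendsto D atTop (𝓝 (m / (m - 1))) := by
    have h1 : Tendsto (fun n => m * a n * (1 - a n)) atTop (𝓝 (1 * (1 - 1 / m))) :=
      hma.mul (hlim.const_sub 1)
    have h2 := h1.inv₀ (by rw [one_mul]; linarith)
    have e : (1 * (1 - 1 / (m : ℝ)))⁻¹ = m / (m - 1) := by
      have : (m : ℝ) - 1 ≠ 0 := by linarith
      field_simp
    rw [e] at h2
    refine h2.congr fun n => ?_
    simp [hD]
  have herr : Tendsto (fun n => 3 * m * (s / σ) ^ n * D n + 2 * |D n - m / (m - 1)|) atTop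
      (𝓝 0) := by
    have h1 := ((tendsto_pow_atTop_nhds_zero_of_lt_one (by positivity)
      ((div_lt_one hσ0).2 hsσ)).const_mul (3 * (m : ℝ))).mul hDlim
    have h2 := ((hDlim.sub_const ((m : ℝ) / (m - 1))).abs).const_mul 2
    simpa using h1.add h2
  filter_upwards [herr.eventually_lt_const hδ, hlim.eventually_lt_const hm1,
    hlim.eventually_const_lt (show 0 < 1 / (m : ℝ) by positivity)] with n hn ha1 ha0 p hp
  have hR := h.abs_mul_dvdMean_sub_le p hp
  have hR' := h.abs_mul_dvdMean_zero_sub_one_le (n := n)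
  have hE := h.abs_re_twistedMean_le p hp
  have he := (Complex.abs_re_le_norm _).trans
    (abs_le_one_of_twistedMean_one fun x => MvPolynomial.eval x p)
  rw [boolCorr_eq p ha0 ha1]
  rw [show dvdMean m (0 : Cube n → ZMod 2) = a n from rfl] at hR' ⊢
  change 0 < a n at ha0
  change a n < 1 at ha1
  set S := dvdMean m (fun x => MvPolynomial.eval x p)
  set e := (twistedMean 1 fun x => MvPolynomial.eval x p).re
  set E := (twistedMean (unitRoot m L) fun x => MvPolynomial.eval x p).re
  have hD0 : 0 < D n := by
    have : 0 < 1 - a n := by linarith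
    simp only [hD]
    positivity
  have h1 : |m * (S - a n * e) - 2 * E| ≤ 3 * m * s ^ n := by
    have e1 : m * (S - a n * e) - 2 * E = (m * S - e - 2 * E) - (m * a n - 1) * e := by ring
    have e2 : |(m * a n - 1) * e| ≤ 2 * m * s ^ n := by
      rw [abs_mul]
      exact (mul_le_of_le_one_right (abs_nonneg _) he).trans hR'
    rw [e1]
    refine (abs_sub _ _).trans ?_
    linarith
  have h2 : |S - a n * e| / (a n * (1 - a n)) = D n * |m * (S - a n * e)| := by
    have : 1 - a n ≠ 0 := by linarith
    rw [abs_mul, abs_of_pos hm0]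
    simp only [hD]
    field_simp
  have h3 : 2 * (m : ℝ) / ((m : ℝ) - 1) * |E| = (m / (m - 1)) * |2 * E| := by
    rw [abs_mul, abs_two]; ring
  rw [h2, h3]
  have h4 : D n * |m * (S - a n * e)| - (m / (m - 1)) * |2 * E| =
      D n * (|m * (S - a n * e)| - |2 * E|) + 2 * |E| * (D n - m / (m - 1)) := by
    rw [abs_mul 2 E, abs_two]; ring
  rw [h4]
  refine (abs_add_le _ _).trans ?_
  rw [abs_mul, abs_mul (2 * |E|), abs_of_pos hD0, abs_of_nonneg (show 0 ≤ 2 * |E| by positivity)]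
  have h5 := (abs_abs_sub_abs_le_abs_sub (m * (S - a n * e)) (2 * E)).trans h1
  calc _ ≤ D n * (3 * m * s ^ n) + 2 * σ ^ n * |D n - m / (m - 1)| := by gcongr
    _ = (3 * m * (s / σ) ^ n * D n + 2 * |D n - m / (m - 1)|) * σ ^ n := by
        rw [div_pow]
        field_simp
    _ ≤ δ * σ ^ n := by gcongr

/-! ### Asymptotics of the twisted means of the symmetric polynomials -/

theorem one_add_exp_div_two (x : ℝ) :
    (1 + Complex.exp ((2 * x : ℝ) * Complex.I)) / 2 =
      (Real.cos x : ℂ) * Complex.exp (x * Complex.I) := by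
  have h : Complex.exp ((2 * x : ℝ) * Complex.I) =
      Complex.exp (x * Complex.I) * Complex.exp (x * Complex.I) := by
    rw [← Complex.exp_add]; congr 1; push_cast; ring
  have h' : Complex.exp (-x * Complex.I) * Complex.exp (x * Complex.I) = 1 := by
    rw [← Complex.exp_add]; simp
  rw [h, Complex.ofReal_cos, Complex.cos]
  linear_combination -h' / 2

theorem exp_bitSign_pi_div_four (b : ZMod 2) :
    (1 + (bitSign b : ℂ) * Complex.I) / 2 =
      ((1 / √2 : ℝ) : ℂ) * Complex.exp ((bitSign b * (Real.pi / 4) : ℝ) * Complex.I) := by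
  have h2 : (√2 : ℝ) * √2 = 2 := Real.mul_self_sqrt (by norm_num)
  have hr : (1 / √2) * (√2 / 2) = (1 : ℝ) / 2 := by field_simp
  have hr' := congrArg (fun r : ℝ => (r : ℂ)) hr
  push_cast at hr'
  rw [Complex.exp_mul_I, ← Complex.ofReal_cos, ← Complex.ofReal_sin]
  rcases zmod_two_cases b with rfl | rfl
  · rw [bitSign_zero, one_mul, Real.cos_pi_div_four, Real.sin_pi_div_four]
    push_cast
    linear_combination -(1 + Complex.I) * hr'
  · rw [bitSign_one, neg_one_mul, Real.cos_neg, Real.sin_neg, Real.cos_pi_div_four,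
      Real.sin_pi_div_four]
    push_cast
    linear_combination -(1 - Complex.I) * hr'

/-- The signed deviation `(θ - π / 2) / 2` of the main angle `θ = ℓ₁ φ` from a right angle. -/
noncomputable def halfDeviation (m : ℕ) (ε : ℤ) : ℝ := ε * (Real.pi / (4 * m))

theorem mainRate_eq_cos {m : ℕ} (hm : 3 ≤ m) : mainRate m = Real.cos (Real.pi / (4 * m)) := by
  have hm' : (3 : ℝ) ≤ m := by exact_mod_cast hm
  have hpi := Real.pi_pos
  have hle : Real.pi / (4 * m) ≤ Real.pi / 2 :=
    div_le_div_of_nonneg_left hpi.le (by norm_num) (by linarith)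
  have hpos : 0 < Real.pi / (4 * m) := by positivity
  have e : Real.pi / (2 * m) = 2 * (Real.pi / (4 * m)) := by ring
  rw [mainRate, e, Real.cos_two_mul, show (1 + (2 * Real.cos (Real.pi / (4 * m)) ^ 2 - 1)) / 2 =
    Real.cos (Real.pi / (4 * m)) ^ 2 by ring, Real.sqrt_sq]
  exact Real.cos_nonneg_of_neg_pi_div_two_le_of_le (by linarith) hle

theorem cos_sign_mul {ε : ℤ} (hε : ε = 1 ∨ ε = -1) (x : ℝ) : Real.cos (ε * x) = Real.cos x := by
  rcases hε with rfl | rfl <;> simp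

theorem NearestQuarter.unitRoot_eq {m L : ℕ} {ε : ℤ} (h : NearestQuarter m L ε) :
    unitRoot m L = Complex.I * Complex.exp ((2 * halfDeviation m ε : ℝ) * Complex.I) := by
  rw [unitRoot_eq_exp, h.angle_eq, ← halfDeviation, Complex.ofReal_add, add_mul, Complex.exp_add]
  congr 1
  push_cast
  exact Complex.exp_pi_div_two_mul_I

theorem NearestQuarter.one_sub_I_mul_unitRoot {m L : ℕ} {ε : ℤ} (h : NearestQuarter m L ε) :
    (1 + -Complex.I * unitRoot m L) / 2 =
      (mainRate m : ℂ) * Complex.exp (halfDeviation m ε * Complex.I) := by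
  rw [h.unitRoot_eq, ← mul_assoc, neg_mul, Complex.I_mul_I, neg_neg, one_mul,
    one_add_exp_div_two, mainRate_eq_cos h.three_le, halfDeviation, cos_sign_mul h.sign]

/-- The modulus of the smaller factor of the twisted mean of `e²` at the main angle. -/
noncomputable def minorRate (m : ℕ) : ℝ := √((1 - Real.cos (Real.pi / (2 * m))) / 2)

theorem minorRate_lt_mainRate {m : ℕ} (hm : 3 ≤ m) : minorRate m < mainRate m := by
  have h0 := cos_pi_div_two_mul_pos hm
  have h1 := cos_pi_div_two_mul_lt_one hm
  exact Real.sqrt_lt_sqrt (by linarith) (by linarith)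

theorem minorRate_nonneg (m : ℕ) : 0 ≤ minorRate m := Real.sqrt_nonneg _

theorem NearestQuarter.unitRoot_im {m L : ℕ} {ε : ℤ} (h : NearestQuarter m L ε) :
    (unitRoot m L).im = Real.cos (Real.pi / (2 * m)) := by
  rw [_root_.unitRoot_im, h.sin_angle]

theorem NearestQuarter.norm_twistedMean_sub_le {m L n : ℕ} {ε : ℤ} (h : NearestQuarter m L ε)
    (b : ZMod 2) :
    ‖twistedMean (unitRoot m L)
        (fun x : Cube n => ((cubeWeight x).choose 2 : ZMod 2) + ∑ i, b * x i) -
      ((mainRate m ^ n / √2 : ℝ) : ℂ) *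
        Complex.exp ((n * halfDeviation m ε + bitSign b * (Real.pi / 4) : ℝ) * Complex.I)‖ ≤
      minorRate m ^ n := by
  set z := unitRoot m L with hz
  have hmain : ((1 + (bitSign b : ℂ) * Complex.I) / 2) * ((1 + -Complex.I * z) / 2) ^ n =
      ((mainRate m ^ n / √2 : ℝ) : ℂ) *
        Complex.exp ((n * halfDeviation m ε + bitSign b * (Real.pi / 4) : ℝ) * Complex.I) := by
    rw [h.one_sub_I_mul_unitRoot, exp_bitSign_pi_div_four, mul_pow, ← Complex.exp_nat_mul,
      Complex.ofReal_add, add_mul, Complex.exp_add]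
    push_cast
    ring_nf
  have hminor : ‖(1 + Complex.I * z) / 2‖ = minorRate m := by
    rw [norm_one_add_I_mul_div_two z (norm_unitRoot m L), hz, h.unitRoot_im, minorRate]
  have hsplit : twistedMean z
        (fun x : Cube n => ((cubeWeight x).choose 2 : ZMod 2) + ∑ i, b * x i) =
      ((1 + (bitSign b : ℂ) * Complex.I) / 2) * ((1 + -Complex.I * z) / 2) ^ n +
      ((1 - (bitSign b : ℂ) * Complex.I) / 2) * ((1 + Complex.I * z) / 2) ^ n := by
    rw [twistedMean_choose_two_add z (fun _ => b), Finset.prod_const, Finset.prod_const,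
      Finset.card_univ, Fintype.card_fin]
    rcases zmod_two_cases b with rfl | rfl
    · simp only [bitSign_zero, Complex.ofReal_one, one_mul]; ring
    · simp only [bitSign_one, Complex.ofReal_neg, Complex.ofReal_one, neg_mul, one_mul,
        sub_neg_eq_add, neg_neg]
      ring
  rw [hsplit, hmain, add_sub_cancel_left, norm_mul, norm_pow, hminor]
  refine mul_le_of_le_one_left (pow_nonneg (minorRate_nonneg m) n) ?_
  have h2 : (1 : ℝ) ≤ √2 := Real.one_le_sqrt.2 (by norm_num)
  have h3 : ‖(1 - (bitSign b : ℂ) * Complex.I) / 2‖ = 1 / √2 := by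
    rcases zmod_two_cases b with rfl | rfl
    · rw [bitSign_zero, Complex.ofReal_one, one_mul, norm_one_sub_I_div_two]
    · rw [bitSign_one, Complex.ofReal_neg, Complex.ofReal_one, neg_one_mul, sub_neg_eq_add,
        norm_one_add_I_div_two]
  rw [h3]
  exact (div_le_one (by linarith)).2 h2

/-- The polynomials `e²` and `e² + e¹`. -/
noncomputable def symPoly (n : ℕ) (b : ZMod 2) : Poly2 n :=
  if b = 0 then elemSym2 n else elemSym2 n + elemSym1 n

theorem eval_symPoly {n : ℕ} (b : ZMod 2) (x : Cube n) :
    MvPolynomial.eval x (symPoly n b) = ((cubeWeight x).choose 2 : ZMod 2) + ∑ i, b * x i := by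
  rcases zmod_two_cases b with rfl | rfl
  · simp [symPoly, eval_elemSym2]
  · simp [symPoly, eval_elemSym2, eval_elemSym1]

theorem totalDegree_symPoly_le (n : ℕ) (b : ZMod 2) : (symPoly n b).totalDegree ≤ 2 := by
  unfold symPoly
  split_ifs
  exacts [totalDegree_elemSym2_le n, totalDegree_elemSym2_add_elemSym1_le n]

theorem eval_onTail {n : ℕ} (s : Poly2 n) (x : Cube (n + 1)) :
    MvPolynomial.eval x (onTail s) = MvPolynomial.eval (fun i => x i.succ) s := by
  rw [onTail, MvPolynomial.eval_rename]; rfl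

/-- The polynomial `a x₁ + s(x₂, …)`, where `a = 1` if `ε = 1` and `a = 0` otherwise. -/
noncomputable def tailPoly {n : ℕ} (ε : ℤ) (s : Poly2 n) : Poly2 (n + 1) :=
  if ε = 1 then MvPolynomial.X 0 + onTail s else onTail s

theorem totalDegree_tailPoly_le {n : ℕ} (ε : ℤ) {s : Poly2 n} (hs : s.totalDegree ≤ 2) :
    (tailPoly ε s).totalDegree ≤ 2 := by
  have h : (onTail s).totalDegree ≤ 2 := (MvPolynomial.totalDegree_rename_le _ _).trans hs
  unfold tailPoly
  split_ifs
  · refine (MvPolynomial.totalDegree_add _ _).trans (max_le ?_ h)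
    simp
  · exact h

theorem twistedMean_tailPoly {n : ℕ} {ε : ℤ} (hε : ε = 1 ∨ ε = -1) (z : ℂ) (s : Poly2 n) :
    twistedMean z (fun x => MvPolynomial.eval x (tailPoly ε s)) =
      (1 + -(ε : ℂ) * z) / 2 * twistedMean z (fun x => MvPolynomial.eval x s) := by
  have hw : ∀ (a : ZMod 2) (h : Cube n),
      cubeWeight (Fin.cons a h : Cube (n + 1)) = a.val + cubeWeight h := fun a h => by
    rw [cubeWeight, Fin.sum_univ_succ]; rfl
  have h0 : ∀ h : Cube n, MvPolynomial.eval (Fin.cons 0 h : Cube (n + 1)) (tailPoly ε s) =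
      MvPolynomial.eval h s := fun h => by
    unfold tailPoly
    split_ifs
    · rw [map_add, MvPolynomial.eval_X, eval_onTail]; exact zero_add _
    · rw [eval_onTail]; rfl
  have h1 : ∀ h : Cube n,
      (bitSign (MvPolynomial.eval (Fin.cons 1 h : Cube (n + 1)) (tailPoly ε s)) : ℂ) =
        -(ε : ℂ) * bitSign (MvPolynomial.eval h s) := fun h => by
    rcases hε with rfl | rfl
    · have : MvPolynomial.eval (Fin.cons 1 h : Cube (n + 1)) (tailPoly 1 s) =
          1 + MvPolynomial.eval h s := by
        rw [tailPoly, if_pos rfl, map_add, MvPolynomial.eval_X, eval_onTail]; rfl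
      rw [this, bitSign_add, bitSign_one]; push_cast; ring
    · have : MvPolynomial.eval (Fin.cons 1 h : Cube (n + 1)) (tailPoly (-1) s) =
          MvPolynomial.eval h s := by
        rw [tailPoly, if_neg (by norm_num), eval_onTail]; rfl
      rw [this]; push_cast; ring
  rw [twistedMean, twistedMean, sum_cube_succ]
  simp only [h0, h1, hw, ZMod.val_zero, ZMod.val_one, zero_add, pow_add, pow_one]
  have e : ∀ h : Cube n, -(ε : ℂ) * bitSign (MvPolynomial.eval h s) * (z * z ^ cubeWeight h) =
      -(ε : ℂ) * z * (bitSign (MvPolynomial.eval h s) * z ^ cubeWeight h) := fun h => by ring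
  rw [Finset.sum_congr rfl fun h _ => e h, ← Finset.mul_sum]
  field_simp

/-- The factor that the extra variable of `tailPoly` contributes. Its modulus exceeds
`mainRate m / √2` by the factor `1 + tan (π / 4m)`. -/
theorem NearestQuarter.one_sub_sign_mul_unitRoot {m L : ℕ} {ε : ℤ} (h : NearestQuarter m L ε) :
    (1 + -(ε : ℂ) * unitRoot m L) / 2 =
      (Real.cos (Real.pi / 4 - Real.pi / (4 * m)) : ℂ) *
        Complex.exp ((halfDeviation m ε - ε * (Real.pi / 4) : ℝ) * Complex.I) := by
  have e1 : -(ε : ℂ) * unitRoot m L =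
      Complex.exp ((2 * (halfDeviation m ε - ε * (Real.pi / 4)) : ℝ) * Complex.I) := by
    rw [h.unitRoot_eq, mul_sub, Complex.ofReal_sub, sub_mul, Complex.exp_sub, ← mul_assoc,
      mul_comm (-(ε : ℂ) * Complex.I), div_eq_mul_inv]
    congr 1
    rcases h.sign with rfl | rfl
    · have : ((2 * (((1 : ℤ) : ℝ) * (Real.pi / 4)) : ℝ) : ℂ) * Complex.I =
          Real.pi / 2 * Complex.I := by push_cast; ring
      rw [this, Complex.exp_pi_div_two_mul_I, Complex.inv_I]; simp
    · have : ((2 * (((-1 : ℤ) : ℝ) * (Real.pi / 4)) : ℝ) : ℂ) * Complex.I =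
          -(Real.pi / 2 * Complex.I) := by push_cast; ring
      rw [this, Complex.exp_neg, Complex.exp_pi_div_two_mul_I, inv_inv]; simp
  have e2 : halfDeviation m ε - ε * (Real.pi / 4) =
      ε * (-(Real.pi / 4 - Real.pi / (4 * m))) := by
    rw [halfDeviation]; ring
  rw [e1, one_add_exp_div_two]
  congr 2
  rw [e2, cos_sign_mul h.sign, Real.cos_neg]

theorem abs_re_sub_le (w : ℂ) (A u δ : ℝ)
    (h : ‖w - (A : ℂ) * Complex.exp ((u : ℝ) * Complex.I)‖ ≤ δ) (hA : 0 ≤ A) :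
    |(|w.re| - A * |Real.cos u|)| ≤ δ := by
  have h1 := (Complex.abs_re_le_norm _).trans h
  rw [Complex.sub_re, Complex.re_ofReal_mul, Complex.exp_ofReal_mul_I_re] at h1
  have h2 := (abs_abs_sub_abs_le_abs_sub w.re (A * Real.cos u)).trans h1
  rwa [abs_mul, abs_of_nonneg hA] at h2

theorem NearestQuarter.abs_re_symPoly_sub_le {m L n : ℕ} {ε : ℤ} (h : NearestQuarter m L ε)
    (b : ZMod 2) :
    |(|(twistedMean (unitRoot m L) fun x => MvPolynomial.eval x (symPoly n b)).re| -
      mainRate m ^ n / √2 * |Real.cos (n * halfDeviation m ε + bitSign b * (Real.pi / 4))|)| ≤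
      minorRate m ^ n := by
  have h0 := mainRate_pos h.three_le
  refine abs_re_sub_le _ _ _ _ ?_ (by positivity)
  simp only [eval_symPoly]
  exact h.norm_twistedMean_sub_le b

theorem NearestQuarter.abs_re_tailPoly_sub_le {m L k : ℕ} {ε : ℤ} (h : NearestQuarter m L ε)
    (b : ZMod 2) :
    |(|(twistedMean (unitRoot m L) fun x =>
        MvPolynomial.eval x (tailPoly ε (symPoly k b))).re| -
      Real.cos (Real.pi / 4 - Real.pi / (4 * m)) * (mainRate m ^ k / √2) *
        |Real.cos (((k + 1 : ℕ) : ℝ) * halfDeviation m ε +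
          (bitSign b - ε) * (Real.pi / 4))|)| ≤ minorRate m ^ k := by
  have h0 := mainRate_pos h.three_le
  have hm' : (3 : ℝ) ≤ m := by exact_mod_cast h.three_le
  have hpi := Real.pi_pos
  have hpos : 0 < Real.pi / (4 * m) := by positivity
  have hle : Real.pi / (4 * m) ≤ Real.pi / 4 :=
    div_le_div_of_nonneg_left hpi.le (by norm_num) (by linarith)
  have hA : 0 ≤ Real.cos (Real.pi / 4 - Real.pi / (4 * m)) :=
    Real.cos_nonneg_of_neg_pi_div_two_le_of_le (by linarith) (by linarith)
  refine abs_re_sub_le _ _ _ _ ?_ (by positivity)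
  have h1 := h.norm_twistedMean_sub_le (n := k) b
  rw [twistedMean_tailPoly h.sign, h.one_sub_sign_mul_unitRoot]
  simp only [eval_symPoly]
  have e : ((Real.cos (Real.pi / 4 - Real.pi / (4 * m)) * (mainRate m ^ k / √2) : ℝ) : ℂ) *
      Complex.exp ((((k + 1 : ℕ) : ℝ) * halfDeviation m ε +
        (bitSign b - ε) * (Real.pi / 4) : ℝ) * Complex.I) =
      (Real.cos (Real.pi / 4 - Real.pi / (4 * m)) : ℂ) *
        Complex.exp ((halfDeviation m ε - ε * (Real.pi / 4) : ℝ) * Complex.I) *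
      (((mainRate m ^ k / √2 : ℝ) : ℂ) *
        Complex.exp ((k * halfDeviation m ε + bitSign b * (Real.pi / 4) : ℝ) * Complex.I)) := by
    have e' : (((k + 1 : ℕ) : ℝ) * halfDeviation m ε + (bitSign b - ε) * (Real.pi / 4) : ℝ) =
        (halfDeviation m ε - ε * (Real.pi / 4)) +
          (k * halfDeviation m ε + bitSign b * (Real.pi / 4)) := by
      push_cast; ring
    rw [e', Complex.ofReal_add, add_mul, Complex.exp_add, Complex.ofReal_mul]
    ring
  rw [e, ← mul_sub, norm_mul]
  refine (mul_le_of_le_one_left (norm_nonneg _) ?_).trans h1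
  rw [norm_mul, Complex.norm_exp_ofReal_mul_I, mul_one, Complex.norm_real, Real.norm_eq_abs,
    abs_of_nonneg hA]
  exact Real.cos_le_one _

/-! ### Phases -/

/-- An odd integer becomes a multiple of four after adding `1` or `-1`. -/
theorem exists_bitSign_add_eq {o : ℤ} (ho : Odd o) :
    ∃ (b : ZMod 2) (k : ℤ), (o : ℝ) + bitSign b = 4 * k := by
  obtain ⟨j, rfl⟩ := ho
  rcases Int.even_or_odd j with ⟨i, rfl⟩ | ⟨i, rfl⟩
  · exact ⟨1, i, by rw [bitSign_one]; push_cast; ring⟩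
  · exact ⟨0, i + 1, by rw [bitSign_zero]; push_cast; ring⟩

theorem exists_le_abs_cos (u : ℝ) :
    ∃ b : ZMod 2, 1 / √2 ≤ |Real.cos (u + bitSign b * (Real.pi / 4))| := by
  by_contra hcon
  push Not at hcon
  have h2 : (1 / √2) ^ 2 = (1 : ℝ) / 2 := by rw [div_pow, Real.sq_sqrt (by norm_num)]; norm_num
  have hlt : ∀ b : ZMod 2, Real.cos (u + bitSign b * (Real.pi / 4)) ^ 2 < 1 / 2 := fun b => by
    rw [← h2, ← sq_abs]
    exact pow_lt_pow_left₀ (hcon b) (abs_nonneg _) (by norm_num)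
  have h0 := hlt 0
  have h1 := hlt 1
  have e : u + bitSign 0 * (Real.pi / 4) = (u + bitSign 1 * (Real.pi / 4)) + Real.pi / 2 := by
    rw [bitSign_zero, bitSign_one]; ring
  rw [e, Real.cos_add_pi_div_two] at h0
  have := Real.sin_sq_add_cos_sq (u + bitSign 1 * (Real.pi / 4))
  linarith

theorem odd_sign_mul {ε : ℤ} (hε : ε = 1 ∨ ε = -1) {o : ℤ} (ho : Odd o) : Odd (ε * o) := by
  rcases hε with rfl | rfl
  · simpa using ho
  · simpa using ho

theorem NearestQuarter.mul_halfDeviation {m L : ℕ} {ε : ℤ} (h : NearestQuarter m L ε) (t : ℝ) :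
    (m * t) * halfDeviation m ε = (ε * t) * (Real.pi / 4) := by
  have hm' : (m : ℝ) ≠ 0 := by have := h.three_le; positivity
  rw [halfDeviation]
  field_simp

/-- If `n` is an odd multiple of `m`, then one of the two phases is real. -/
theorem NearestQuarter.exists_abs_cos_eq_one {m L n : ℕ} {ε : ℤ} (h : NearestQuarter m L ε)
    (hn : n ≡ m [MOD 4 * m] ∨ n ≡ 3 * m [MOD 4 * m]) :
    ∃ b : ZMod 2, |Real.cos (n * halfDeviation m ε + bitSign b * (Real.pi / 4))| = 1 := by
  obtain ⟨o, ho, hno⟩ : ∃ o : ℤ, Odd o ∧ (n : ℝ) = m * o := by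
    rcases hn with hn | hn
    · obtain ⟨k, hk⟩ := (Nat.modEq_iff_dvd.1 hn)
      refine ⟨1 - 4 * k, ⟨-2 * k, by ring⟩, ?_⟩
      have : (n : ℤ) = m * (1 - 4 * k) := by push_cast at hk; linarith
      exact_mod_cast this
    · obtain ⟨k, hk⟩ := (Nat.modEq_iff_dvd.1 hn)
      refine ⟨3 - 4 * k, ⟨1 - 2 * k, by ring⟩, ?_⟩
      have : (n : ℤ) = m * (3 - 4 * k) := by push_cast at hk; linarith
      exact_mod_cast this
  obtain ⟨b, k, hb⟩ := exists_bitSign_add_eq (odd_sign_mul h.sign ho)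
  refine ⟨b, ?_⟩
  have e : (n : ℝ) * halfDeviation m ε + bitSign b * (Real.pi / 4) = k * Real.pi := by
    rw [hno, h.mul_halfDeviation]
    push_cast at hb
    linear_combination (Real.pi / 4) * hb
  rw [e, Real.abs_cos_int_mul_pi]

theorem exists_eq_mul_two_mul {m n : ℕ}
    (hn : n ≡ 0 [MOD 4 * m] ∨ n ≡ 2 * m [MOD 4 * m]) : ∃ t : ℤ, (n : ℝ) = m * (2 * t) := by
  rcases hn with hn | hn
  · obtain ⟨k, hk⟩ := (Nat.modEq_iff_dvd.1 hn)
    refine ⟨-2 * k, ?_⟩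
    have : (n : ℤ) = m * (2 * (-2 * k)) := by push_cast at hk; linarith
    exact_mod_cast this
  · obtain ⟨k, hk⟩ := (Nat.modEq_iff_dvd.1 hn)
    refine ⟨1 - 2 * k, ?_⟩
    have : (n : ℤ) = m * (2 * (1 - 2 * k)) := by push_cast at hk; linarith
    exact_mod_cast this

/-- If `n` is an even multiple of `m`, then both phases are odd multiples of `π / 4`. -/
theorem NearestQuarter.abs_cos_eq_of_even {m L n : ℕ} {ε : ℤ} (h : NearestQuarter m L ε)
    (hn : n ≡ 0 [MOD 4 * m] ∨ n ≡ 2 * m [MOD 4 * m]) (b : ZMod 2) :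
    |Real.cos (n * halfDeviation m ε + bitSign b * (Real.pi / 4))| = 1 / √2 := by
  obtain ⟨t, ht⟩ := exists_eq_mul_two_mul hn
  rw [ht, h.mul_halfDeviation]
  have hsq : Real.cos (ε * (2 * t) * (Real.pi / 4) + bitSign b * (Real.pi / 4)) ^ 2 = 1 / 2 := by
    rw [Real.cos_sq]
    have h0 : Real.cos (2 * (ε * (2 * t) * (Real.pi / 4) + bitSign b * (Real.pi / 4))) = 0 := by
      rw [Real.cos_eq_zero_iff]
      rcases zmod_two_cases b with rfl | rfl
      · exact ⟨ε * t, by rw [bitSign_zero]; push_cast; ring⟩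
      · exact ⟨ε * t - 1, by rw [bitSign_one]; push_cast; ring⟩
    rw [h0]; norm_num
  rw [← Real.sqrt_sq_eq_abs, hsq, one_div, Real.sqrt_inv, one_div]

/-- If `n` is an even multiple of `m`, then one of the phases with an extra linear term is real. -/
theorem NearestQuarter.exists_abs_cos_tail_eq_one {m L n : ℕ} {ε : ℤ} (h : NearestQuarter m L ε)
    (hn : n ≡ 0 [MOD 4 * m] ∨ n ≡ 2 * m [MOD 4 * m]) :
    ∃ b : ZMod 2,
      |Real.cos (n * halfDeviation m ε + (bitSign b - ε) * (Real.pi / 4))| = 1 := by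
  obtain ⟨t, ht⟩ := exists_eq_mul_two_mul hn
  obtain ⟨b, k, hb⟩ := exists_bitSign_add_eq (odd_sign_mul h.sign (o := 2 * t - 1)
    ⟨t - 1, by ring⟩)
  refine ⟨b, ?_⟩
  have e : (n : ℝ) * halfDeviation m ε + (bitSign b - ε) * (Real.pi / 4) = k * Real.pi := by
    rw [ht, h.mul_halfDeviation]
    push_cast at hb
    linear_combination (Real.pi / 4) * hb
  rw [e, Real.abs_cos_int_mul_pi]

/-! ### Boolean correlations on the exponential scale -/

/-- The scale `(2m / (m - 1)) σ^n` of Boolean correlations, where `σ = mainRate m`. -/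
noncomputable def corrScale (m n : ℕ) : ℝ := 2 * (m : ℝ) / ((m : ℝ) - 1) * mainRate m ^ n

theorem one_le_two_mul_div {m : ℕ} (hm : 3 ≤ m) : 1 ≤ 2 * (m : ℝ) / ((m : ℝ) - 1) := by
  have hm' : (3 : ℝ) ≤ m := by exact_mod_cast hm
  rw [le_div_iff₀ (by linarith)]
  linarith

theorem corrScale_pos {m : ℕ} (hm : 3 ≤ m) (n : ℕ) : 0 < corrScale m n :=
  mul_pos (by linarith [one_le_two_mul_div hm]) (pow_pos (mainRate_pos hm) n)

theorem pow_mainRate_le_corrScale {m : ℕ} (hm : 3 ≤ m) (n : ℕ) :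
    mainRate m ^ n ≤ corrScale m n :=
  le_mul_of_one_le_left (pow_nonneg (mainRate_pos hm).le n) (one_le_two_mul_div hm)

theorem eventually_pow_le {τ σ δ : ℝ} (hτ : 0 ≤ τ) (hτσ : τ < σ) (hδ : 0 < δ) :
    ∀ᶠ n : ℕ in atTop, τ ^ n ≤ δ * σ ^ n := by
  have hσ : 0 < σ := hτ.trans_lt hτσ
  have h := tendsto_pow_atTop_nhds_zero_of_lt_one (by positivity) ((div_lt_one hσ).2 hτσ)
  filter_upwards [h.eventually_lt_const hδ] with n hn
  rw [div_pow, div_lt_iff₀ (by positivity)] at hn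
  exact hn.le

theorem abs_sub_scaled_le {B C E X Y δ y : ℝ} (hY : C * X = Y) (hC : 1 ≤ C) (hy : 0 ≤ δ * y)
    (h1 : |B - C * abs E| ≤ δ / 2 * y) (h2 : |(|E| - X)| ≤ δ / 2 * y) :
    |B - Y| ≤ δ * (C * y) := by
  rw [← hY]
  have e : B - C * X = (B - C * |E|) + C * (|E| - X) := by ring
  rw [e]
  refine (abs_add_le _ _).trans ?_
  rw [abs_mul, abs_of_nonneg (by linarith : (0 : ℝ) ≤ C)]
  have h3 : C * |(|E| - X)| ≤ C * (δ / 2 * y) := mul_le_mul_of_nonneg_left h2 (by linarith)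
  nlinarith

theorem NearestQuarter.abs_boolCorr_symPoly_sub_le {m L : ℕ} {ε : ℤ} (h : NearestQuarter m L ε)
    {δ : ℝ} (hδ : 0 < δ) : ∀ᶠ n : ℕ in atTop, ∀ b : ZMod 2,
      |boolCorr m (symPoly n b) - corrScale m n *
        (|Real.cos (n * halfDeviation m ε + bitSign b * (Real.pi / 4))| / √2)| ≤
        δ * corrScale m n := by
  have hm := h.three_le
  filter_upwards [h.abs_boolCorr_sub_le (half_pos hδ), eventually_pow_le (minorRate_nonneg m)
    (minorRate_lt_mainRate hm) (half_pos hδ)] with n h1 h2 b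
  have hσ := mainRate_pos hm
  refine abs_sub_scaled_le ?_ (one_le_two_mul_div hm)
    (mul_nonneg hδ.le (pow_nonneg hσ.le n)) (h1 _ (totalDegree_symPoly_le n b))
    ((h.abs_re_symPoly_sub_le b).trans h2)
  rw [corrScale]; ring

theorem NearestQuarter.abs_boolCorr_tailPoly_sub_le {m L : ℕ} {ε : ℤ} (h : NearestQuarter m L ε)
    {δ : ℝ} (hδ : 0 < δ) : ∀ᶠ k : ℕ in atTop, ∀ b : ZMod 2,
      |boolCorr m (tailPoly ε (symPoly k b)) - corrScale m (k + 1) *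
        ((1 + Real.tan (Real.pi / (4 * m))) / 2 *
          |Real.cos (((k + 1 : ℕ) : ℝ) * halfDeviation m ε +
            (bitSign b - ε) * (Real.pi / 4))|)| ≤ δ * corrScale m (k + 1) := by
  have hm := h.three_le
  have hσ := mainRate_pos hm
  filter_upwards [(tendsto_add_atTop_nat 1).eventually (h.abs_boolCorr_sub_le (half_pos hδ)),
    eventually_pow_le (minorRate_nonneg m) (minorRate_lt_mainRate hm)
      (mul_pos (half_pos hδ) hσ)] with k h1 h2 b
  refine abs_sub_scaled_le ?_ (one_le_two_mul_div hm)
    (mul_nonneg hδ.le (pow_nonneg hσ.le (k + 1)))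
    (h1 _ (totalDegree_tailPoly_le ε (totalDegree_symPoly_le k b)))
    ((h.abs_re_tailPoly_sub_le b).trans (h2.trans_eq (by ring)))
  have hcos : Real.cos (Real.pi / (4 * m)) ≠ 0 := by
    rw [← mainRate_eq_cos hm]; exact hσ.ne'
  have hA : Real.cos (Real.pi / 4 - Real.pi / (4 * m)) =
      √2 / 2 * (mainRate m * (1 + Real.tan (Real.pi / (4 * m)))) := by
    rw [Real.cos_sub, Real.cos_pi_div_four, Real.sin_pi_div_four, mainRate_eq_cos hm, mul_add,
      mul_one, mul_comm (Real.cos (Real.pi / (4 * m))) (Real.tan _), Real.tan_mul_cos hcos]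
    ring
  rw [hA, corrScale, pow_succ]
  field_simp

theorem NearestQuarter.boolCorr_linear_le {m L : ℕ} {ε : ℤ} (h : NearestQuarter m L ε)
    {δ : ℝ} (hδ : 0 < δ) : ∀ᶠ n : ℕ in atTop,
      boolCorr m (0 : Poly2 n) ≤ δ * corrScale m n ∧
        boolCorr m (elemSym1 n) ≤ δ * corrScale m n := by
  have hm := h.three_le
  have hL4 := h.four_mul
  have hε := h.sign
  filter_upwards [h.abs_boolCorr_sub_le (half_pos hδ), eventually_pow_le
    (cos_pi_div_two_mul_pos hm).le (cos_lt_mainRate hm) (half_pos hδ)] with n h1 h2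
  have key : ∀ (p : Poly2 n) (b : ZMod 2), p.totalDegree ≤ 2 →
      (∀ x, MvPolynomial.eval x p = ∑ i, b * x i) → boolCorr m p ≤ δ * corrScale m n := by
    intro p b hp hb
    have h3 := norm_twistedMean_const_mul_sum_le (n := n) (ℓ := L) hm h.odd (by omega) (by omega) b
    rw [← funext hb] at h3
    have h4 := abs_sub_scaled_le (X := 0) (mul_zero _) (one_le_two_mul_div hm)
      (mul_nonneg hδ.le (pow_nonneg (mainRate_pos hm).le n)) (h1 p hp)
      (by rw [sub_zero, abs_abs]; exact ((Complex.abs_re_le_norm _).trans h3).trans h2)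
    rw [sub_zero] at h4
    exact (le_abs_self _).trans h4
  exact ⟨key 0 0 (by simp) (by simp),
    key _ 1 (totalDegree_elemSym1_le n) (by simp [eval_elemSym1])⟩

theorem NearestQuarter.psiBound_bounds {m L : ℕ} {ε : ℤ} (h : NearestQuarter m L ε)
    (hL : ellOne m = L) {δ : ℝ} (hδ : 0 < δ) : ∀ᶠ n : ℕ in atTop,
      corrScale m n / √2 ≤ psiBound m n ∧ psiBound m n ≤ corrScale m n * (1 / √2 + δ) := by
  have hm := h.three_le
  have hσ := mainRate_pos hm
  filter_upwards [eventually_pow_le (minorRate_nonneg m) (minorRate_lt_mainRate hm) hδ] with n hn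
  have hs0 := cos_pi_div_two_mul_pos hm
  have hs1 := cos_pi_div_two_mul_lt_one hm
  have hC := one_le_two_mul_div hm
  have hpow : ∀ r : ℝ, 0 ≤ r → (√(r / 2) ^ n) ^ 2 = r ^ n / 2 ^ n := fun r hr => by
    rw [← pow_mul, mul_comm, pow_mul, Real.sq_sqrt (by linarith), div_pow]
  have hv : vAngle n ((ellOne m : ℝ) * (2 * Real.pi / m)) =
      ((mainRate m ^ n) ^ 2 + (minorRate m ^ n) ^ 2) / 2 := by
    rw [hL, vAngle, Int.cast_natCast, h.sin_angle, mainRate, minorRate, hpow _ (by linarith),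
      hpow _ (by linarith)]
    field_simp
    ring
  have h2 : (√2 : ℝ) * √2 = 2 := Real.mul_self_sqrt (by norm_num)
  have h20 : 0 < (√2 : ℝ) := by positivity
  have hτ := pow_nonneg (minorRate_nonneg m) n
  have hσn := pow_pos hσ n
  have hi : (1 / √2 : ℝ) ^ 2 = 1 / 2 := by rw [div_pow, Real.sq_sqrt (by norm_num)]; norm_num
  have hi1 : (1 / √2 : ℝ) ≤ 1 := by
    rw [div_le_one h20]; exact Real.one_le_sqrt.2 (by norm_num)
  have hi0 : 0 < (1 / √2 : ℝ) := by positivity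
  rw [psiBound, hv]
  constructor
  · rw [corrScale, mul_div_assoc]
    refine mul_le_mul_of_nonneg_left (Real.le_sqrt_of_sq_le ?_) (by linarith)
    rw [div_pow, Real.sq_sqrt (by norm_num)]
    have := sq_nonneg (minorRate m ^ n)
    linarith
  · rw [corrScale, mul_assoc]
    refine mul_le_mul_of_nonneg_left ((Real.sqrt_le_left (by positivity)).2 ?_) (by linarith)
    have h3 : (minorRate m ^ n) ^ 2 ≤ (δ * mainRate m ^ n) ^ 2 := pow_le_pow_left₀ hτ hn 2
    have h4 : (mainRate m ^ n * (1 / √2 + δ)) ^ 2 =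
        (mainRate m ^ n) ^ 2 * (1 / 2 + 2 * (1 / √2) * δ + δ ^ 2) := by
      rw [mul_pow, add_sq, hi]
    rw [h4]
    have h5 : 0 ≤ (mainRate m ^ n) ^ 2 * (2 * (1 / √2) * δ) := by positivity
    have h6 : 0 ≤ (mainRate m ^ n) ^ 2 * δ ^ 2 := by positivity
    nlinarith

theorem boolCorr_congr_const_add {m n : ℕ} (p q : Poly2 n) (c : ZMod 2)
    (h : ∀ x, MvPolynomial.eval x p = c + MvPolynomial.eval x q) : boolCorr m p = boolCorr m q := by
  have hs : ∀ x, polySign p x = bitSign c * polySign q x := fun x => by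
    change bitSign _ = _ * bitSign _
    rw [h, bitSign_add]
  unfold boolCorr
  simp only [hs, ← Finset.mul_expect]
  rw [← mul_sub, abs_mul, abs_bitSign, one_mul]

/-- Every quadratic polynomial either falls short of the best possible correlation by a fixed
factor or has the correlation of `e²` or `e² + e¹`. -/
theorem NearestQuarter.exists_boolCorr_le_or_symm {m L : ℕ} {ε : ℤ} (h : NearestQuarter m L ε) :
    ∃ β : ℝ, 0 ≤ β ∧ β < 1 / √2 ∧ ∀ᶠ n : ℕ in atTop, ∀ p : Poly2 n, p.totalDegree ≤ 2 →
      boolCorr m p ≤ β * corrScale m n ∨ ∃ b, boolCorr m p = boolCorr m (symPoly n b) := by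
  have hm := h.three_le
  have hm' : (3 : ℝ) ≤ m := by exact_mod_cast hm
  have hpi := Real.pi_pos
  -- The worst case is `m = 3`, where the sine is `√3 / 2`.
  have him : 0.86 ≤ (unitRoot m L).im := by
    rw [h.unitRoot_im]
    have h1 : Real.cos (Real.pi / 6) ≤ Real.cos (Real.pi / (2 * m)) := by
      refine Real.cos_le_cos_of_nonneg_of_le_pi (by positivity) (by linarith) ?_
      exact div_le_div_of_nonneg_left hpi.le (by norm_num) (by linarith)
    rw [Real.cos_pi_div_six] at h1
    have h2 : 1.72 ≤ √3 := Real.le_sqrt_of_sq_le (by norm_num)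
    linarith
  obtain ⟨β, hβ0, hβ, hev⟩ := exists_norm_twistedMean_le_or_symm _ (norm_unitRoot m L) him
  have hδ : 0 < (1 / √2 - β) / 2 := by linarith
  refine ⟨β + (1 / √2 - β) / 2, by linarith, by linarith, ?_⟩
  filter_upwards [hev, h.abs_boolCorr_sub_le hδ] with n h1 h2 p hp
  rcases h1 p hp with h3 | ⟨c, h3 | h3⟩
  · left
    rw [h.unitRoot_im] at h3
    have h4 := (Complex.abs_re_le_norm _).trans h3
    have h5 := (abs_le.1 (h2 p hp)).2
    have h6 := mul_le_mul_of_nonneg_left (pow_mainRate_le_corrScale hm n) hδ.le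
    have h7 := mul_le_mul_of_nonneg_left h4
      (by linarith [one_le_two_mul_div hm] : (0 : ℝ) ≤ 2 * (m : ℝ) / ((m : ℝ) - 1))
    have h8 : 2 * (m : ℝ) / ((m : ℝ) - 1) * (β * √((1 + Real.cos (Real.pi / (2 * m))) / 2) ^ n) =
        β * corrScale m n := by
      rw [corrScale, mainRate]; ring
    rw [h8] at h7
    rw [add_mul]
    linarith
  · exact Or.inr ⟨0, boolCorr_congr_const_add _ _ c h3⟩
  · exact Or.inr ⟨1, boolCorr_congr_const_add _ _ c h3⟩

theorem boolCorr_le_maxQuadCorr {m n : ℕ} (p : Poly2 n) (hp : p.totalDegree ≤ 2) :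
    boolCorr m p ≤ maxQuadCorr m n :=
  (maxQuadCorr_isGreatest m n).2 ⟨p, hp, rfl⟩

theorem exists_boolCorr_eq_maxQuadCorr (m n : ℕ) :
    ∃ p : Poly2 n, p.totalDegree ≤ 2 ∧ maxQuadCorr m n = boolCorr m p :=
  (maxQuadCorr_isGreatest m n).1

theorem boolCorr_symPoly_le_max {m n : ℕ} (b : ZMod 2) : boolCorr m (symPoly n b) ≤
    max (boolCorr m (elemSym2 n)) (boolCorr m (elemSym2 n + elemSym1 n)) := by
  unfold symPoly
  split_ifs
  exacts [le_max_left _ _, le_max_right _ _]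

theorem max_boolCorr_le_maxQuadCorr (m n : ℕ) :
    max (boolCorr m (elemSym2 n)) (boolCorr m (elemSym2 n + elemSym1 n)) ≤ maxQuadCorr m n :=
  max_le (boolCorr_le_maxQuadCorr _ (totalDegree_elemSym2_le n))
    (boolCorr_le_maxQuadCorr _ (totalDegree_elemSym2_add_elemSym1_le n))

theorem one_div_sqrt_two_bounds :
    (0.7 : ℝ) < 1 / √2 ∧ (1 / √2) * (1 / √2) = (1 : ℝ) / 2 := by
  have h2 : (√2 : ℝ) * √2 = 2 := Real.mul_self_sqrt (by norm_num)
  have h20 : 0 < (√2 : ℝ) := by positivity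
  refine ⟨?_, ?_⟩
  · rw [lt_div_iff₀ h20]; nlinarith
  · field_simp; linarith

theorem NearestQuarter.maxQuadCorr_le {m L : ℕ} {ε : ℤ} (h : NearestQuarter m L ε)
    {δ : ℝ} (hδ : 0 < δ) : ∀ᶠ n : ℕ in atTop,
      maxQuadCorr m n ≤ corrScale m n * (1 / √2 + δ) := by
  have hm := h.three_le
  obtain ⟨β, -, hβ, hev⟩ := h.exists_boolCorr_le_or_symm
  filter_upwards [hev, h.abs_boolCorr_symPoly_sub_le hδ] with n h1 h2
  have hW := corrScale_pos hm n
  obtain ⟨p, hp, hmax⟩ := exists_boolCorr_eq_maxQuadCorr m n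
  rw [hmax]
  rcases h1 p hp with h3 | ⟨b, h3⟩
  · exact h3.trans (by nlinarith)
  · rw [h3]
    have h4 := (abs_le.1 (h2 b)).2
    have h5 : corrScale m n *
        (|Real.cos (n * halfDeviation m ε + bitSign b * (Real.pi / 4))| / √2) ≤
        corrScale m n * (1 / √2) := by
      gcongr
      exact Real.abs_cos_le_one _
    linarith

/-- A lower bound for the better one of `e²` and `e² + e¹`, in terms of their phases. -/
theorem NearestQuarter.scale_le_max_symm {m L : ℕ} {ε : ℤ} (h : NearestQuarter m L ε)
    {δ : ℝ} (hδ : 0 < δ) : ∀ᶠ n : ℕ in atTop, ∀ r : ℝ,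
      (∃ b : ZMod 2, r ≤ |Real.cos (n * halfDeviation m ε + bitSign b * (Real.pi / 4))|) →
      corrScale m n * (r * (1 / √2) - δ) ≤
        max (boolCorr m (elemSym2 n)) (boolCorr m (elemSym2 n + elemSym1 n)) := by
  have hm := h.three_le
  filter_upwards [h.abs_boolCorr_symPoly_sub_le hδ] with n h2 r hr
  obtain ⟨b, hb⟩ := hr
  refine le_trans ?_ (boolCorr_symPoly_le_max b)
  have hW := corrScale_pos hm n
  have h4 := (abs_le.1 (h2 b)).1
  have h5 : corrScale m n * (r * (1 / √2)) ≤ corrScale m n *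
      (|Real.cos (n * halfDeviation m ε + bitSign b * (Real.pi / 4))| / √2) := by
    rw [mul_one_div]
    gcongr
  linarith

theorem NearestQuarter.maxQuadCorr_bounds {m L : ℕ} {ε : ℤ} (h : NearestQuarter m L ε)
    (hL : ellOne m = L) {e : ℝ} (he : 0 < e) : ∀ᶠ n : ℕ in atTop,
      psiBound m n * (1 / √2 - e) ≤ maxQuadCorr m n ∧
        maxQuadCorr m n ≤ psiBound m n * (1 + e) := by
  have hm := h.three_le
  obtain ⟨hr1, hr3⟩ := one_div_sqrt_two_bounds
  have hδ : 0 < e / 10 := by positivity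
  filter_upwards [h.psiBound_bounds hL hδ, h.maxQuadCorr_le hδ, h.scale_le_max_symm hδ] with n
    hpsi hup hlow
  obtain ⟨hp1, hp2⟩ := hpsi
  have hW := corrScale_pos hm n
  have hl := (hlow (1 / √2) (exists_le_abs_cos _)).trans (max_boolCorr_le_maxQuadCorr m n)
  rw [hr3] at hl
  rw [← mul_one_div] at hp1
  set r := 1 / √2
  set W := corrScale m n
  have hψ : 0 ≤ psiBound m n := le_trans (by positivity) hp1
  constructor
  · rcases le_total (r - e) 0 with hneg | hpos
    · refine (mul_nonpos_of_nonneg_of_nonpos hψ hneg).trans ?_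
      exact (abs_nonneg _).trans (boolCorr_le_maxQuadCorr (0 : Poly2 n) (by simp))
    · calc psiBound m n * (r - e) ≤ W * (r + e / 10) * (r - e) := by gcongr
        _ = W * ((r + e / 10) * (r - e)) := by ring
        _ ≤ W * (1 / 2 - e / 10) := mul_le_mul_of_nonneg_left (by nlinarith) hW.le
        _ ≤ _ := hl
  · calc maxQuadCorr m n ≤ W * (r + e / 10) := hup
      _ ≤ W * (r * (1 + e)) := mul_le_mul_of_nonneg_left (by nlinarith) hW.le
      _ = W * r * (1 + e) := by ring
      _ ≤ psiBound m n * (1 + e) := by gcongr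

theorem NearestQuarter.maxQuadCorr_eq_of_odd_multiple {m L : ℕ} {ε : ℤ}
    (h : NearestQuarter m L ε) : ∀ᶠ n : ℕ in atTop,
      n ≡ m [MOD 4 * m] ∨ n ≡ 3 * m [MOD 4 * m] → maxQuadCorr m n =
        max (boolCorr m (elemSym2 n)) (boolCorr m (elemSym2 n + elemSym1 n)) := by
  have hm := h.three_le
  obtain ⟨β, -, hβ, hev⟩ := h.exists_boolCorr_le_or_symm
  filter_upwards [hev, h.scale_le_max_symm (show 0 < 1 / √2 - β by linarith)] with n h1 h2 hn
  refine le_antisymm ?_ (max_boolCorr_le_maxQuadCorr m n)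
  obtain ⟨b, hb⟩ := h.exists_abs_cos_eq_one hn
  obtain ⟨p, hp, hmax⟩ := exists_boolCorr_eq_maxQuadCorr m n
  rw [hmax]
  rcases h1 p hp with h3 | ⟨b', h3⟩
  · refine h3.trans (le_trans (le_of_eq ?_) (h2 1 ⟨b, hb.ge⟩))
    ring
  · rw [h3]
    exact boolCorr_symPoly_le_max b'

theorem NearestQuarter.abs_maxQuadCorr_sub_le_of_odd_multiple {m L : ℕ} {ε : ℤ}
    (h : NearestQuarter m L ε) (hL : ellOne m = L) {e : ℝ} (he : 0 < e) : ∀ᶠ n : ℕ in atTop,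
      n ≡ m [MOD 4 * m] ∨ n ≡ 3 * m [MOD 4 * m] →
        |maxQuadCorr m n - psiBound m n| ≤ e * psiBound m n := by
  have hm := h.three_le
  obtain ⟨hr1, -⟩ := one_div_sqrt_two_bounds
  have hδ : 0 < e / 10 := by positivity
  filter_upwards [h.psiBound_bounds hL hδ, h.maxQuadCorr_le hδ, h.scale_le_max_symm hδ] with n
    hpsi hup hlow hn
  obtain ⟨hp1, hp2⟩ := hpsi
  have hW := corrScale_pos hm n
  obtain ⟨b, hb⟩ := h.exists_abs_cos_eq_one hn
  have hl := (hlow 1 ⟨b, hb.ge⟩).trans (max_boolCorr_le_maxQuadCorr m n)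
  rw [← mul_one_div] at hp1
  have h1 : e * (0.7 * corrScale m n) ≤ e * psiBound m n := by
    gcongr
    nlinarith
  have h2 := mul_pos hW he
  rw [abs_le]
  constructor <;> nlinarith

theorem NearestQuarter.symm_lt_tail_of_even_multiple {m L : ℕ} {ε : ℤ}
    (h : NearestQuarter m L ε) : ∃ c : ℝ, 0 < c ∧ ∀ᶠ k : ℕ in atTop,
      k + 1 ≡ 0 [MOD 4 * m] ∨ k + 1 ≡ 2 * m [MOD 4 * m] →
        (1 + c) * max (max (boolCorr m (0 : Poly2 (k + 1))) (boolCorr m (elemSym1 (k + 1))))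
            (max (boolCorr m (elemSym2 (k + 1)))
              (boolCorr m (elemSym2 (k + 1) + elemSym1 (k + 1)))) <
          max (boolCorr m (tailPoly ε (elemSym2 k)))
            (boolCorr m (tailPoly ε (elemSym2 k + elemSym1 k))) := by
  have hm := h.three_le
  have hm' : (3 : ℝ) ≤ m := by exact_mod_cast hm
  have hpi := Real.pi_pos
  have hpos : 0 < Real.pi / (4 * m) := by positivity
  have hlt : Real.pi / (4 * m) < Real.pi / 4 :=
    div_lt_div_of_pos_left hpi (by norm_num) (by linarith)
  set q := Real.tan (Real.pi / (4 * m)) with hq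
  have hq0 : 0 < q := Real.tan_pos_of_pos_of_lt_pi_div_two hpos (by linarith)
  have hq1 : q < 1 := by
    rw [← Real.tan_pi_div_four]
    exact Real.tan_lt_tan_of_lt_of_lt_pi_div_two (by linarith) (by linarith) hlt
  obtain ⟨-, hr3⟩ := one_div_sqrt_two_bounds
  have hδ : 0 < q / 8 := by positivity
  -- On the common scale the two sides tend to `1 / 2` and at least `(1 + q) / 2`.
  refine ⟨q / 4, by positivity, ?_⟩
  filter_upwards [h.abs_boolCorr_tailPoly_sub_le hδ,
    (tendsto_add_atTop_nat 1).eventually (h.abs_boolCorr_symPoly_sub_le hδ),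
    (tendsto_add_atTop_nat 1).eventually (h.boolCorr_linear_le hδ)] with k htail hsym hlin hk
  have hW := corrScale_pos hm (k + 1)
  set W := corrScale m (k + 1)
  have hup : ∀ b, boolCorr m (symPoly (k + 1) b) ≤ W * (1 / 2 + q / 8) := fun b => by
    have h1 := (abs_le.1 (hsym b)).2
    rw [h.abs_cos_eq_of_even hk b, ← mul_one_div, hr3] at h1
    linarith
  have hmax : max (max (boolCorr m (0 : Poly2 (k + 1))) (boolCorr m (elemSym1 (k + 1))))
      (max (boolCorr m (elemSym2 (k + 1)))
        (boolCorr m (elemSym2 (k + 1) + elemSym1 (k + 1)))) ≤ W * (1 / 2 + q / 8) :=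
    max_le (max_le (hlin.1.trans (by nlinarith)) (hlin.2.trans (by nlinarith)))
      (max_le (hup 0) (hup 1))
  obtain ⟨b, hb⟩ := h.exists_abs_cos_tail_eq_one hk
  have hlow : W * ((1 + q) / 2 - q / 8) ≤ boolCorr m (tailPoly ε (symPoly k b)) := by
    have h1 := (abs_le.1 (htail b)).1
    rw [hb, mul_one] at h1
    linarith
  have htop : boolCorr m (tailPoly ε (symPoly k b)) ≤
      max (boolCorr m (tailPoly ε (elemSym2 k)))
        (boolCorr m (tailPoly ε (elemSym2 k + elemSym1 k))) := by
    unfold symPoly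
    split_ifs
    exacts [le_max_left _ _, le_max_right _ _]
  calc _ ≤ (1 + q / 4) * (W * (1 / 2 + q / 8)) := by gcongr
    _ = W * ((1 + q / 4) * (1 / 2 + q / 8)) := by ring
    _ < W * ((1 + q) / 2 - q / 8) := mul_lt_mul_of_pos_left (by nlinarith) hW
    _ ≤ _ := hlow.trans htop

theorem mainTheorem2 (m : ℕ) (hm : 3 ≤ m) (hodd : Odd m) :
    -- the maximum is `Ψ` up to a factor between `1/√2 - o(1)` and `1 + o(1)`
    (∀ ε : ℝ, 0 < ε → ∀ᶠ n : ℕ in atTop,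
      psiBound m n * (1 / √2 - ε) ≤ maxQuadCorr m n ∧
        maxQuadCorr m n ≤ psiBound m n * (1 + ε)) ∧
    -- `n ≡ m, 3m` modulo `4m`
    ((∀ᶠ n : ℕ in atTop, n ≡ m [MOD 4 * m] ∨ n ≡ 3 * m [MOD 4 * m] →
        maxQuadCorr m n =
          max (boolCorr m (elemSym2 n)) (boolCorr m (elemSym2 n + elemSym1 n))) ∧
      (∀ ε : ℝ, 0 < ε → ∀ᶠ n : ℕ in atTop,
        n ≡ m [MOD 4 * m] ∨ n ≡ 3 * m [MOD 4 * m] →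
          |maxQuadCorr m n - psiBound m n| ≤ ε * psiBound m n)) ∧
    -- `n ≡ 0, 2m` modulo `4m`, with `n = k + 1`
    (∃ c : ℝ, 0 < c ∧ ∀ᶠ k : ℕ in atTop,
      k + 1 ≡ 0 [MOD 4 * m] ∨ k + 1 ≡ 2 * m [MOD 4 * m] →
        (m ≡ 3 [MOD 4] →
          (1 + c) * max (max (boolCorr m (0 : Poly2 (k + 1))) (boolCorr m (elemSym1 (k + 1))))
              (max (boolCorr m (elemSym2 (k + 1)))
                (boolCorr m (elemSym2 (k + 1) + elemSym1 (k + 1)))) <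
            max (boolCorr m (MvPolynomial.X 0 + onTail (elemSym2 k)))
              (boolCorr m (MvPolynomial.X 0 + onTail (elemSym2 k + elemSym1 k)))) ∧
        (m ≡ 1 [MOD 4] →
          (1 + c) * max (max (boolCorr m (0 : Poly2 (k + 1))) (boolCorr m (elemSym1 (k + 1))))
              (max (boolCorr m (elemSym2 (k + 1)))
                (boolCorr m (elemSym2 (k + 1) + elemSym1 (k + 1)))) <
            max (boolCorr m (onTail (elemSym2 k)))
              (boolCorr m (onTail (elemSym2 k + elemSym1 k))))) := by
  obtain ⟨L, ε, h, hL, h3, h1⟩ := exists_nearestQuarter hm hodd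
  refine ⟨fun e he => h.maxQuadCorr_bounds hL he,
    ⟨h.maxQuadCorr_eq_of_odd_multiple,
      fun e he => h.abs_maxQuadCorr_sub_le_of_odd_multiple hL he⟩, ?_⟩
  obtain ⟨c, hc, hev⟩ := h.symm_lt_tail_of_even_multiple
  refine ⟨c, hc, ?_⟩
  filter_upwards [hev] with k hk hmod
  refine ⟨fun hm3 => ?_, fun hm1 => ?_⟩
  · have hlt := hk hmod
    rw [h3 hm3] at hlt
    simpa only [tailPoly, if_true] using hlt
  · have hlt := hk hmod
    rw [h1 hm1] at hlt
    simpa only [tailPoly, if_neg (show ¬ ((-1 : ℤ) = 1) by decide)] using hlt
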